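/- **Definitions.** All logarithms of $n$ are natural. A *geometry* $(V,d)$ is a finite vertex set $V$ with a semi-metric $d$ (that is, $d(x,y)=d(y,x)\ge 0$, and $d(x,y)=0$ iff $x=y$; no triangle inequality). Let $|V|=n$, fix $\gamma>1$ and let $K=\lceil\log_\gamma n\rceil$. A distance in $(\gamma^{k-1},\gamma^k]$ has *scale* $k$. The geometry is *$\gamma$-coherent* with constants $a>0$, $A>1$, $\phi>0$, $\lambda\in(0,1)$ if every distance between distinct vertices has a scale in $\{0,\dots,K\}$ and (H1) for every vertex $v$, the number $P_k(v)$ of vertices at scale $k$ from $v$ satisfies $a\gamma^k\le P_k(v)\le A\gamma^k$ for $1\le k\le K$, and $P_0(v)\le A$; (H2) for all $v\ne t$, if $d(v,t)$ has scale $k$, then at least $\phi\gamma^k$ vertices $u$ satisfy $d(v,u)\le\gamma^k$ and $d(u,t)\le\lambda\, d(v,t)$. Fix $\alpha>0$. The *cost of indexing* gives every potential edge of scale $k$ the cost $c^*_k=k/\alpha$. For a budget $B$, let $E_\Gamma(B)$ be a uniformly random graph (edge set) among all simple graphs on $V$ of total cost at most $Bn$. A *substrate* is an edge set $E_0$ such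 that for all $s\ne t$ some $\{s,v\}\in E_0$ has $d(v,t)\le d(s,t)-1$. A *decentralized search algorithm* is given a target and a current vertex and chooses the next edge by seeing only the neighbours of the current vertex and their distances to the target; a graph is *$d$-navigable* if such an algorithm finds, for all $s,t$, a path from $s$ to $t$ of length $O(\mathrm{poly}(\log n))$. Let $N_u(r)$ be the number of vertices within distance $r$ of $u$ (including $u$), let $p_k=\frac1n\#\{\text{pairs of vertices at scale } k\}$, and let $\mathbf Q^*(B)$ be the symmetric matrix of edge probabilities in which an edge of scale $k$ has probability $a^*_k/p_k=1/(1+e^{\ell c^*_k})$ with some $\ell=\ell(B)\ge 0$, where $(a^*_k)$ maximizes $-\sum_{k}[(p_k-a_k)\log(p_k-a_k)+a_k\log a_k]$ subject to $0\le a_k\le p_k$ and $\sum_k a_kc^*_k\le B$. **Theorem.** Fix $\gamma,a,A,\phi,\lambda,\alpha$ as above. For every degree $p\in\mathbb N$ and every $\gamma$-coherent geometry on $n$ vertices with these constants there are budgets $0<B^-\le B^+$ such that, as $n\to\infty$ and uniformly over these geometries: 1. $B^+/B^-=\omega((\log n)^p)$. 2. There are $C,q$, depending only on the constants and on $p$,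 such that for all $B\in[B^-,B^+]$: with high probability $|E_\Gamma(B)|\le C\,n(\log n)^q$; and for every substrate $E_0$, with high probability $G(V,E_0\cup E_\Gamma(B))$ is $d$-navigable, with paths of length at most $C(\log n)^q$ found by one decentralized search algorithm that depends on none of the constants, $p$, the geometry, the substrate and the random graph. 3. There is $B_a\in[B^-,B^+]$ such that, for all large $n$, $E_\Gamma(B_a)$ is approximated by the product measure with matrix $\mathbf Q^*=\mathbf Q^*(B_a)$, in the sense that for $\epsilon=\sqrt{24/\log n}$ the random graphs $G^\pm\sim G(n,(1\pm\epsilon)\mathbf Q^*)$ and $E_\Gamma(B_a)$ can be coupled so that $G^-\subseteq E_\Gamma(B_a)\subseteq G^+$ with probability at least $1-2n^{-5K}$; and $\mathbf Q^*_{uv}=\Theta\big(1/N_u(d(u,v))\big)$ for all $u\ne v$, with constants depending only on $\gamma,a,A,\phi,\lambda,\alpha$. That is, rank-based augmentation is approximately recovered. -/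

import Mathlib

open Filter Finset

/-- A geometry: a vertex set with a semi-metric (the triangle inequality is not required). -/
structure Geometry (V : Type*) where
  dist : V → V → ℝ
  dist_nonneg : ∀ x y, 0 ≤ dist x y
  dist_eq_zero : ∀ x y, dist x y = 0 ↔ x = y
  dist_symm : ∀ x y, dist x y = dist y x

/-- The distance `x` lies in the `k`-th `γ`-scale, i.e. in the interval `(γ^(k-1), γ^k]`. -/
def InScale (γ : ℝ) (k : ℕ) (x : ℝ) : Prop :=
  γ ^ ((k : ℤ) - 1) < x ∧ x ≤ γ ^ k

/-- The index of the `γ`-scale of the distance `x`. -/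
noncomputable def scaleIndex (γ x : ℝ) : ℕ := ⌈Real.logb γ x⌉₊

theorem scaleIndex_eq {γ x : ℝ} {k : ℕ} (hγ : 1 < γ) (h : InScale γ k x) :
    scaleIndex γ x = k := by
  have h0 : (0 : ℝ) < γ := by linarith
  have hx : 0 < x := lt_trans (zpow_pos h0 _) h.1
  have hlt : ((k : ℝ) - 1) < Real.logb γ x := by
    rw [Real.lt_logb_iff_rpow_lt hγ hx]
    have := h.1
    rw [← Real.rpow_intCast] at this
    push_cast at this
    exact this
  have hle : Real.logb γ x ≤ (k : ℝ) := by
    rw [Real.logb_le_iff_le_rpow hγ hx, Real.rpow_natCast]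
    exact h.2
  unfold scaleIndex
  apply le_antisymm
  · exact Nat.ceil_le.mpr hle
  · have h1 := Nat.le_ceil (Real.logb γ x)
    have h2 : (k : ℝ) < (⌈Real.logb γ x⌉₊ : ℝ) + 1 := by linarith
    have h3 : k < ⌈Real.logb γ x⌉₊ + 1 := by exact_mod_cast h2
    omega

/-- The number of scales `K = ⌈log_γ n⌉`. -/
noncomputable def numScales (γ : ℝ) (n : ℕ) : ℕ := ⌈Real.logb γ (n : ℝ)⌉₊

namespace Geometry

variable {V : Type*} [Fintype V]

open Classical in
/-- `P_k(v)`: the number of vertices in the `k`-th distance scale from `v`. -/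
noncomputable def scaleCount (Γ : Geometry V) (γ : ℝ) (k : ℕ) (v : V) : ℕ :=
  #{u : V | InScale γ k (Γ.dist v u)}

open Classical in
/-- `D_lam(v,t)`: the `t`-helpful vertices for `v`, when `d(v,t)` is in the `k`-th scale. -/
noncomputable def helpful (Γ : Geometry V) (γ lam : ℝ) (k : ℕ) (v t : V) : Finset V :=
  {u : V | Γ.dist v u ≤ γ ^ k ∧ Γ.dist u t ≤ lam * Γ.dist v t}

open Classical in
/-- `N_u(r)`: the number of vertices within distance `r` of `u`. -/
noncomputable def ballCount (Γ : Geometry V) (u : V) (r : ℝ) : ℕ :=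
  #{w : V | Γ.dist u w ≤ r}

/-- `γ`-coherence with explicit constants: bounded growth (H1) with constants `a, A` and isotropy
(H2) with constants `φ, lam`. The scales `0, ..., K` exhaust the distances between distinct
vertices; scale `0` (distances at most `1`) may be empty, so only the upper growth bound is
asked of it. -/
structure IsCoherent (Γ : Geometry V) (γ a A φ lam : ℝ) : Prop where
  exists_scale : ∀ u v, u ≠ v → ∃ k ≤ numScales γ (Fintype.card V), InScale γ k (Γ.dist u v)
  growth : ∀ v, ∀ k ∈ Finset.Icc 1 (numScales γ (Fintype.card V)),
    a * γ ^ k ≤ Γ.scaleCount γ k v ∧ (Γ.scaleCount γ k v : ℝ) ≤ A * γ ^ k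
  growth_zero : ∀ v, (Γ.scaleCount γ 0 v : ℝ) ≤ A
  isotropy : ∀ v t, v ≠ t → ∀ k, InScale γ k (Γ.dist v t) →
    φ * γ ^ k ≤ #(Γ.helpful γ lam k v t)

/-- A set of edges is a substrate if from every `s ≠ t` some edge of it decreases the distance to
`t` by at least one. -/
def IsSubstrate (Γ : Geometry V) (E₀ : SimpleGraph V) : Prop :=
  ∀ s t, s ≠ t → ∃ v, E₀.Adj s v ∧ Γ.dist v t ≤ Γ.dist s t - 1

/-- The distance between the endpoints of a potential edge. -/
def edgeDist (Γ : Geometry V) : Sym2 V → ℝ :=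
  Sym2.lift ⟨Γ.dist, Γ.dist_symm⟩

/-- The cost of indexing: an edge in the `k`-th `γ`-scale costs `k / α`. -/
noncomputable def indexingCost (Γ : Geometry V) (γ α : ℝ) (e : Sym2 V) : ℝ :=
  (scaleIndex γ (Γ.edgeDist e) : ℝ) / α

open Classical in
/-- `p_k = P_k / n`: the number of potential edges in the `k`-th scale, divided by `n`. -/
noncomputable def scaleDensity (Γ : Geometry V) (γ : ℝ) (k : ℕ) : ℝ :=
  (#{e : Sym2 V | InScale γ k (Γ.edgeDist e)} : ℝ) / Fintype.card V

/-- `x = (x_0, ..., x_K)` is a feasible average-degree profile for the indexing cost and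
budget `B`. -/
def IsFeasibleProfile (Γ : Geometry V) (γ α B : ℝ) (x : ℕ → ℝ) : Prop :=
  (∀ k ∈ range (numScales γ (Fintype.card V) + 1), 0 ≤ x k ∧ x k ≤ Γ.scaleDensity γ k) ∧
  ∑ k ∈ range (numScales γ (Fintype.card V) + 1), x k * ((k : ℝ) / α) ≤ B

/-- The entropy `-∑ₖ [(p_k - x_k) log (p_k - x_k) + x_k log x_k]` of a profile. -/
noncomputable def profileEntropy (Γ : Geometry V) (γ : ℝ) (x : ℕ → ℝ) : ℝ :=
  ∑ k ∈ range (numScales γ (Fintype.card V) + 1),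
    (Real.negMulLog (Γ.scaleDensity γ k - x k) + Real.negMulLog (x k))

/-- `x` is an entropy-maximizing feasible profile for budget `B`. -/
def IsOptimalProfile (Γ : Geometry V) (γ α B : ℝ) (x : ℕ → ℝ) : Prop :=
  Γ.IsFeasibleProfile γ α B x ∧
  ∀ y, Γ.IsFeasibleProfile γ α B y → Γ.profileEntropy γ y ≤ Γ.profileEntropy γ x

end Geometry

section RandomGraphs

variable {V : Type*} [Fintype V]

open Classical in
/-- The number of edges of a graph. -/
noncomputable def edgeCount (G : SimpleGraph V) : ℕ := #{e : Sym2 V | e ∈ G.edgeSet}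

open Classical in
/-- The graphs on `V` of total cost at most `B * n`, where `n` is the number of vertices. -/
noncomputable def boundedCostGraphs (c : Sym2 V → ℝ) (B : ℝ) : Finset (SimpleGraph V) :=
  {G : SimpleGraph V | (1 / (Fintype.card V : ℝ)) * ∑ e : Sym2 V with e ∈ G.edgeSet, c e ≤ B}

open Classical in
/-- The probability of the property `P` for a uniformly random element of `S`. -/
noncomputable def uniformProb (S : Finset (SimpleGraph V)) (P : SimpleGraph V → Prop) : ℝ :=
  (#{G ∈ S | P G} : ℝ) / #S

open Classical in
/-- The probability of `G` under the uniform measure on `S`. -/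
noncomputable def uniformMass (S : Finset (SimpleGraph V)) (G : SimpleGraph V) : ℝ :=
  if G ∈ S then 1 / (#S : ℝ) else 0

open Classical in
/-- The probability of `G` under the product measure in which every potential edge `e` is present
independently with probability `Q e`. -/
noncomputable def productMass (Q : Sym2 V → ℝ) (G : SimpleGraph V) : ℝ :=
  ∏ e : Sym2 V with ¬ e.IsDiag, if e ∈ G.edgeSet then Q e else 1 - Q e

open Classical in
/-- The uniform measure on `S` is `(ε, δ)`-sandwiched by `Q`: there is a coupling `w` of
`G⁻ ∼ G(n, (1-ε)Q)`, `G ∼ U(S)` and `G⁺ ∼ G(n, (1+ε)Q)` under which `G⁻ ⊆ G ⊆ G⁺` with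
probability at least `1 - δ`. -/
def IsSandwichedBy (S : Finset (SimpleGraph V)) (Q : Sym2 V → ℝ) (ε δ : ℝ) : Prop :=
  (∀ e, ¬ e.IsDiag → 0 ≤ (1 - ε) * Q e ∧ (1 + ε) * Q e ≤ 1) ∧
  ∃ w : SimpleGraph V → SimpleGraph V → SimpleGraph V → ℝ,
    (∀ H G H', 0 ≤ w H G H') ∧
    (∀ H, ∑ G, ∑ H', w H G H' = productMass (fun e => (1 - ε) * Q e) H) ∧
    (∀ G, ∑ H, ∑ H', w H G H' = uniformMass S G) ∧
    (∀ H', ∑ H, ∑ G, w H G H' = productMass (fun e => (1 + ε) * Q e) H') ∧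
    1 - δ ≤ ∑ H, ∑ G, ∑ H', if H ≤ G ∧ G ≤ H' then w H G H' else 0

/-- The edge probabilities `1 / (1 + exp (l * c e))`. -/
noncomputable def gibbsMatrix (c : Sym2 V → ℝ) (l : ℝ) (e : Sym2 V) : ℝ :=
  1 / (1 + Real.exp (l * c e))

end RandomGraphs

section Navigability

variable {V : Type*} [Fintype V]

/-- A decentralized search algorithm: given the target, the current vertex, and the neighbours of
the current vertex, each with its distance to the target, it names the vertex to move to. It has
no other access to the graph or to the geometry. -/
abbrev DecentralizedAlgorithm (V : Type*) : Type _ := V → V → Finset (V × ℝ) → V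

open Classical in
/-- What the algorithm is shown at the vertex `v` when the target is `t`. -/
noncomputable def localView (Γ : Geometry V) (G : SimpleGraph V) (t v : V) : Finset (V × ℝ) :=
  ({u : V | G.Adj v u} : Finset V).image fun u => (u, Γ.dist u t)

/-- The vertex reached by the algorithm from `s` after `i` moves, when the target is `t`. -/
noncomputable def searchWalk (alg : DecentralizedAlgorithm V) (Γ : Geometry V)
    (G : SimpleGraph V) (s t : V) (i : ℕ) : V :=
  (fun v => alg t v (localView Γ G t v))^[i] s

/-- For any `s` and `t`, the algorithm finds a path of the graph from `s` to `t` of length at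
most `L`. -/
def NavigableBy (alg : DecentralizedAlgorithm V) (Γ : Geometry V) (G : SimpleGraph V)
    (L : ℝ) : Prop :=
  ∀ s t, ∃ m : ℕ, (m : ℝ) ≤ L ∧ searchWalk alg Γ G s t m = t ∧
    ∀ i < m, G.Adj (searchWalk alg Γ G s t i) (searchWalk alg Γ G s t (i + 1))

end Navigability

/-!
Write a graph as a configuration of its potential edges, grouped into scales, and let `μ_l` be the
Gibbs measure in which an edge of cost `c` is present with probability `1 / (1 + exp (l c))`,
independently of the others. At `l = α log γ` an edge of scale `k` has probability
`1 / (1 + γ ^ k)`, which by bounded growth is the inverse rank up to constants. The lower end of the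
window of budgets is the mean cost per vertex of this measure; it is of order at most `(log n) ^ 2`
(`Geometry.IsCoherent.meanCost_rank_le`), whereas the mean cost at `l = 0` is at least linear in `n`
(`Geometry.IsCoherent.le_meanCost_zero`). So the upper end may be larger than the lower one by a
factor `(log n) ^ (p + 1)`, and every budget `B` in the window is the mean cost of some `μ_l` with
`0 ≤ l ≤ α log γ` (`Geometry.IsCoherent.exists_meanCost_eq`).

The uniform measure on the graphs of cost at most `B n` is compared with `μ_l` by
`card_bounded_cost_le`: its probabilities exceed those of `μ_l` by a factor `exp (O((log n) ^ 2))` at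
most. Indeed, `μ_l` gives mass at least `exp (-O((log n) ^ 2))` to the graphs whose number of edges in
each scale is the integer part of the mean, since a binomial variable attains the integer part of its
mean with a polynomially small probability and there are only `O(log n)` scales. These graphs are
admissible, of nearly maximal cost, and `μ_l` depends on the cost only.

*Sparsity* is deterministic: an edge outside scale `0` costs at least `1 / α`, and scale `0` has
`O(n)` potential edges.

*Navigability*: the algorithm is greedy search. Under `μ_l` every vertex `v ≠ t` has a helpful edge
with probability bounded below, and the edges at the successive vertices of a greedy path are
independent as far as they matter, because only edges to vertices closer to the target are used
(`prodProb_stalls_le`). Thus a run of `C (log n) ^ 2` consecutive moves without a helpful one has a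
probability that beats the price of the change of measure, and `O(log n)` helpful moves suffice.

*Sandwich*: the numbers of edges in the scales `k ≥ 1` concentrate, with an error
`exp (-c n / log n)` that again beats the price of the change of measure. Scale `0` may have few
potential edges, but these are free of charge, hence are independent fair coins under the uniform
measure, and can be coupled one by one. All three laws are invariant under permutations within the
scales, so that nested edge numbers in each scale can be turned into nested graphs by one common
random permutation (`exists_nested_coupling`).
-/

/-! ### Product measures on finite configuration spaces -/

/-- The marginals of a family of independent Bernoulli variables. -/
def bern {ι : Type*} (q : ι → ℝ) (i : ι) (b : Bool) : ℝ := if b then q i else 1 - q i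

theorem bern_nonneg {ι : Type*} {q : ι → ℝ} (h0 : ∀ i, 0 ≤ q i) (h1 : ∀ i, q i ≤ 1) (i : ι) (b : Bool) :
    0 ≤ bern q i b := by
  unfold bern
  split_ifs
  · exact h0 i
  · linarith [h1 i]

theorem sum_bern {ι : Type*} (q : ι → ℝ) (i : ι) : ∑ b, bern q i b = 1 := by
  simp [bern]

section ProductMeasure

variable {ι β : Type*} [Fintype ι]

/-- The mass of the configuration `x` when its coordinates are independent and the `i`-th one
takes the value `b` with probability `ω i b`. -/
def prodWeight (ω : ι → β → ℝ) (x : ι → β) : ℝ := ∏ i, ω i (x i)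

open Classical in
/-- The probability of the event `P` under the product measure `prodWeight ω`. -/
noncomputable def prodProb [DecidableEq ι] [Fintype β] (ω : ι → β → ℝ) (P : (ι → β) → Prop) : ℝ :=
  ∑ x with P x, prodWeight ω x

theorem prodWeight_nonneg {ω : ι → β → ℝ} (h : ∀ i b, 0 ≤ ω i b) (x : ι → β) :
    0 ≤ prodWeight ω x :=
  prod_nonneg fun i _ => h i _

variable [DecidableEq ι] [Fintype β]

theorem sum_prodWeight_mul_prod (ω g : ι → β → ℝ) :
    ∑ x, prodWeight ω x * ∏ i, g i (x i) = ∏ i, ∑ b, ω i b * g i b := by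
  rw [Fintype.prod_sum]
  exact sum_congr rfl fun x _ => prod_mul_distrib.symm

theorem sum_prodWeight {ω : ι → β → ℝ} (h : ∀ i, ∑ b, ω i b = 1) :
    ∑ x, prodWeight ω x = 1 := by
  have := sum_prodWeight_mul_prod ω (fun _ _ => 1)
  simpa [h] using this

theorem prodProb_mono {ω : ι → β → ℝ} (h : ∀ i b, 0 ≤ ω i b) {P Q : (ι → β) → Prop}
    (hPQ : ∀ x, P x → Q x) : prodProb ω P ≤ prodProb ω Q := by
  classical
  refine sum_le_sum_of_subset_of_nonneg (fun x hx => ?_) fun x _ _ => prodWeight_nonneg h x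
  simp only [mem_filter, mem_univ, true_and] at hx ⊢
  exact hPQ x hx

theorem prodProb_nonneg {ω : ι → β → ℝ} (h : ∀ i b, 0 ≤ ω i b) (P : (ι → β) → Prop) :
    0 ≤ prodProb ω P := sum_nonneg fun x _ => prodWeight_nonneg h x

theorem prodProb_le_one {ω : ι → β → ℝ} (h : ∀ i b, 0 ≤ ω i b) (h1 : ∀ i, ∑ b, ω i b = 1)
    (P : (ι → β) → Prop) : prodProb ω P ≤ 1 := by
  classical
  rw [← sum_prodWeight h1]
  exact sum_le_sum_of_subset_of_nonneg (subset_univ _) fun x _ _ => prodWeight_nonneg h x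

theorem prodProb_exists_le {ω : ι → β → ℝ} (h : ∀ i b, 0 ≤ ω i b) {τ : Type*} (s : Finset τ)
    (P : τ → (ι → β) → Prop) :
    prodProb ω (fun x => ∃ j ∈ s, P j x) ≤ ∑ j ∈ s, prodProb ω (P j) := by
  classical
  unfold prodProb
  simp only [sum_filter]
  rw [sum_comm]
  refine sum_le_sum fun x _ => ?_
  split_ifs with hx
  · obtain ⟨j, hj, hP⟩ := hx
    refine le_trans (le_of_eq ?_) (single_le_sum (f := fun j => if P j x then prodWeight ω x else 0)
      (fun j _ => ?_) hj)
    · simp [hP]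
    · split_ifs
      · exact prodWeight_nonneg h x
      · exact le_rfl
  · refine sum_nonneg fun j _ => ?_
    split_ifs
    · exact prodWeight_nonneg h x
    · exact le_rfl

/-- Functions of disjoint sets of coordinates are uncorrelated under a product measure. Exchanging
the coordinates outside `I` between two independent configurations preserves their joint law and
moves both functions to the same configuration. -/
theorem sum_prodWeight_mul_mul {ω : ι → β → ℝ} (h : ∀ i, ∑ b, ω i b = 1) (I : ι → Prop)
    {f g : (ι → β) → ℝ} (hf : ∀ x y, (∀ i, I i → x i = y i) → f x = f y)
    (hg : ∀ x y, (∀ i, ¬ I i → x i = y i) → g x = g y) :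
    ∑ x, prodWeight ω x * (f x * g x) =
      (∑ x, prodWeight ω x * f x) * ∑ x, prodWeight ω x * g x := by
  classical
  let mix : (ι → β) → (ι → β) → ι → β := fun x y i => if I i then x i else y i
  let swap : (ι → β) × (ι → β) → (ι → β) × (ι → β) := fun p => (mix p.1 p.2, mix p.2 p.1)
  have hinv : Function.Involutive swap := by
    rintro ⟨x, y⟩
    ext i <;> by_cases hi : I i <;> simp [swap, mix, hi]
  have hw : ∀ x y, prodWeight ω (mix x y) * prodWeight ω (mix y x)
      = prodWeight ω x * prodWeight ω y := by
    intro x y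
    simp only [prodWeight, ← prod_mul_distrib]
    refine prod_congr rfl fun i _ => ?_
    by_cases hi : I i <;> simp [mix, hi, mul_comm]
  have hf' : ∀ x y, f (mix x y) = f x := fun x y => hf _ _ fun i hi => by simp [mix, hi]
  have hg' : ∀ x y, g (mix x y) = g y := fun x y => hg _ _ fun i hi => by simp [mix, hi]
  have key : ∑ p : (ι → β) × (ι → β), prodWeight ω p.1 * prodWeight ω p.2 * (f p.1 * g p.1)
      = ∑ p : (ι → β) × (ι → β), prodWeight ω p.1 * prodWeight ω p.2 * (f p.1 * g p.2) := by
    rw [← Equiv.sum_comp hinv.toPerm]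
    refine sum_congr rfl fun p _ => ?_
    change prodWeight ω (mix p.1 p.2) * prodWeight ω (mix p.2 p.1)
      * (f (mix p.1 p.2) * g (mix p.1 p.2)) = _
    rw [hw, hf', hg']
  rw [Fintype.sum_prod_type, Fintype.sum_prod_type] at key
  rw [sum_mul_sum]
  calc _ = ∑ x, ∑ y, prodWeight ω x * prodWeight ω y * (f x * g x) := by
        refine sum_congr rfl fun x _ => ?_
        rw [← sum_mul, ← mul_sum, sum_prodWeight h, mul_one]
    _ = _ := by
        rw [key]
        exact sum_congr rfl fun x _ => sum_congr rfl fun y _ => by ring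

theorem prodProb_and_eq_mul {ω : ι → β → ℝ} (h : ∀ i, ∑ b, ω i b = 1) (I : ι → Prop)
    {P Q : (ι → β) → Prop} (hP : ∀ x y, (∀ i, I i → x i = y i) → (P x ↔ P y))
    (hQ : ∀ x y, (∀ i, ¬ I i → x i = y i) → (Q x ↔ Q y)) :
    prodProb ω (fun x => P x ∧ Q x) = prodProb ω P * prodProb ω Q := by
  classical
  have := sum_prodWeight_mul_mul h I (f := fun x => if P x then (1 : ℝ) else 0)
    (g := fun x => if Q x then (1 : ℝ) else 0) (fun x y hxy => by simp only [hP x y hxy])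
    (fun x y hxy => by simp only [hQ x y hxy])
  simp only [prodProb, sum_filter]
  simp only [mul_ite, mul_one, mul_zero] at this
  rw [← this]
  refine sum_congr rfl fun x _ => ?_
  by_cases hPx : P x <;> by_cases hQx : Q x <;> simp [hPx, hQx]

/-- The law of a coordinatewise image of independent variables. -/
theorem sum_prodWeight_map {δ : Type*} [DecidableEq δ] (ω : ι → β → ℝ) (φ : β → δ) (y : ι → δ) :
    (∑ x, if (fun i => φ (x i)) = y then prodWeight ω x else 0)
      = ∏ i, ∑ b, if φ b = y i then ω i b else 0 := by
  have := sum_prodWeight_mul_prod ω (fun i b => if φ b = y i then 1 else 0)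
  simp only [mul_ite, mul_one, mul_zero] at this
  rw [← this]
  refine sum_congr rfl fun x _ => ?_
  by_cases hx : (fun i => φ (x i)) = y
  · have : ∀ i, φ (x i) = y i := fun i => congrFun hx i
    simp [this]
  · rw [if_neg hx]
    obtain ⟨i, hi⟩ := Function.ne_iff.mp hx
    rw [prod_eq_zero (mem_univ i) (by simp [hi]), mul_zero]

/-- Independent coordinates are unlikely to be all `false` if the sum of their marginals is large. -/
theorem prodProb_forall_false_le {q : ι → ℝ} (h1 : ∀ i, q i ≤ 1) (s : Finset ι) :
    prodProb (bern q) (fun x => ∀ i ∈ s, x i = false) ≤ Real.exp (-∑ i ∈ s, q i) := by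
  classical
  have := sum_prodWeight_mul_prod (bern q) (fun i b => if i ∈ s then (if b then 0 else 1) else 1)
  have e : prodProb (bern q) (fun x => ∀ i ∈ s, x i = false)
      = ∏ i, ∑ b, bern q i b * (if i ∈ s then (if b then 0 else 1) else 1) := by
    rw [← this, prodProb, sum_filter]
    refine sum_congr rfl fun x _ => ?_
    split_ifs with hx
    · rw [prod_eq_one, mul_one]
      intro i _
      by_cases hi : i ∈ s <;> simp [hi, hx]
    · push Not at hx
      obtain ⟨i, hi, hxi⟩ := hx
      rw [prod_eq_zero (mem_univ i) (by simp [hi, hxi]), mul_zero]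
  rw [e, ← sum_neg_distrib, Real.exp_sum, ← prod_filter_mul_prod_filter_not univ (· ∈ s)]
  have h2 : ∏ i with i ∉ s, ∑ b, bern q i b * (if i ∈ s then (if b then 0 else 1) else 1)
      = (1 : ℝ) := by
    refine prod_eq_one fun i hi => ?_
    have hi : i ∉ s := by simpa using hi
    simp [hi, bern]
  rw [h2, mul_one]
  have h3 : (univ.filter (· ∈ s)) = s := by ext; simp
  rw [h3]
  refine prod_le_prod (fun i hi => ?_) fun i hi => ?_
  · simp [hi, bern, h1 i]
  · have := Real.add_one_le_exp (-q i)
    simp [hi, bern]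
    linarith

/-- A Chernoff bound for the linear statistic `∑ i, θ i x i`: the second order Taylor expansion
of the moment generating function, valid as long as `|θ i| ≤ 1`. -/
theorem prodProb_linear_ge_le {q : ι → ℝ} (h0 : ∀ i, 0 ≤ q i) (h1 : ∀ i, q i ≤ 1) (θ : ι → ℝ)
    (hθ : ∀ i, |θ i| ≤ 1) (s : ℝ) :
    prodProb (bern q) (fun x => s ≤ (∑ i, if x i then θ i else 0) - ∑ i, q i * θ i) ≤
      Real.exp (-s + ∑ i, q i * θ i ^ 2) := by
  classical
  have hmgf : ∑ x, prodWeight (bern q) x * Real.exp (∑ i, if x i then θ i else 0) ≤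
      Real.exp (∑ i, (q i * θ i + q i * θ i ^ 2)) := by
    simp_rw [Real.exp_sum]
    rw [sum_prodWeight_mul_prod (bern q) (fun i b => Real.exp (if b then θ i else 0))]
    refine prod_le_prod (fun i _ => sum_nonneg fun b _ =>
      mul_nonneg (bern_nonneg h0 h1 i b) (Real.exp_nonneg _)) fun i _ => ?_
    have h2 := (abs_le.mp (Real.abs_exp_sub_one_sub_id_le (hθ i))).2
    have h3 := Real.add_one_le_exp (q i * θ i + q i * θ i ^ 2)
    simp only [bern, Fintype.univ_bool, mem_singleton, Bool.true_eq_false, not_false_eq_true,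
      sum_insert, if_true, sum_singleton, Bool.false_eq_true, if_false, Real.exp_zero]
    nlinarith [mul_le_mul_of_nonneg_left h2 (h0 i)]
  have hM : prodProb (bern q) (fun x => s ≤ (∑ i, if x i then θ i else 0) - ∑ i, q i * θ i) ≤
      Real.exp (-s - ∑ i, q i * θ i) *
        ∑ x, prodWeight (bern q) x * Real.exp (∑ i, if x i then θ i else 0) := by
    rw [prodProb, sum_filter, mul_sum]
    refine sum_le_sum fun x _ => ?_
    have hw := prodWeight_nonneg (bern_nonneg h0 h1) x
    split_ifs with hx
    · have : (1 : ℝ) ≤ Real.exp (-s - ∑ i, q i * θ i) * Real.exp (∑ i, if x i then θ i else 0) := by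
        rw [← Real.exp_add]
        apply Real.one_le_exp
        linarith
      nlinarith
    · positivity
  refine hM.trans ((mul_le_mul_of_nonneg_left hmgf (Real.exp_nonneg _)).trans (le_of_eq ?_))
  rw [← Real.exp_add, sum_add_distrib]
  congr 1
  ring

end ProductMeasure

/-! ### Bernoulli variables grouped into scales -/

section Scales

variable {ι : Type*} [Fintype ι]

/-- The number of coordinates in scale `k`, for the scale function `κ`. -/
def scaleSize (κ : ι → ℕ) (k : ℕ) : ℕ := #{i | κ i = k}

/-- The number of coordinates in scale `k` at which the configuration `x` is `true`. -/
def scaleNum (κ : ι → ℕ) (k : ℕ) (x : ι → Bool) : ℕ := #{i | κ i = k ∧ x i = true}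

/-- The cost of a configuration: the sum of the costs of its `true` coordinates. -/
def configCost (c : ι → ℝ) (x : ι → Bool) : ℝ := ∑ i, if x i then c i else 0

theorem scaleNum_le_scaleSize (κ : ι → ℕ) (k : ℕ) (x : ι → Bool) :
    scaleNum κ k x ≤ scaleSize κ k :=
  card_le_card fun i hi => by
    simp only [mem_filter, mem_univ, true_and] at hi ⊢
    exact hi.1

theorem sum_eq_sum_scaleSize {κ : ι → ℕ} {K : ℕ} (hκ : ∀ i, κ i ≤ K) (f : ℕ → ℝ) :
    ∑ i, f (κ i) = ∑ k ∈ range (K + 1), (scaleSize κ k : ℝ) * f k := by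
  rw [← sum_fiberwise_of_maps_to (g := κ) (t := range (K + 1)) fun i _ =>
    mem_range.mpr (Nat.lt_succ_of_le (hκ i))]
  refine sum_congr rfl fun k _ => ?_
  rw [sum_congr rfl (g := fun _ => f k) fun i hi => by rw [(mem_filter.mp hi).2], sum_const,
    nsmul_eq_mul, scaleSize]

theorem configCost_eq_sum_scaleNum {κ : ι → ℕ} {K : ℕ} (hκ : ∀ i, κ i ≤ K) (w : ℕ → ℝ)
    (x : ι → Bool) :
    configCost (fun i => w (κ i)) x = ∑ k ∈ range (K + 1), (scaleNum κ k x : ℝ) * w k := by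
  rw [configCost, ← sum_fiberwise_of_maps_to (g := κ) (t := range (K + 1)) fun i _ =>
    mem_range.mpr (Nat.lt_succ_of_le (hκ i))]
  refine sum_congr rfl fun k _ => ?_
  rw [← sum_filter, filter_filter, sum_congr rfl (g := fun _ => w k) fun i hi => by
    rw [(mem_filter.mp hi).2.1], sum_const, nsmul_eq_mul, scaleNum]

variable [DecidableEq ι]

/-- The number of `true` coordinates in a scale on which the marginals are constant is binomial.
The proof reads off the coefficients of the probability generating function. -/
theorem prodProb_scaleNum_eq {κ : ι → ℕ} {q : ι → ℝ} {r : ℝ} {k : ℕ}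
    (hq : ∀ i, κ i = k → q i = r) (j : ℕ) :
    prodProb (bern q) (fun x => scaleNum κ k x = j) =
      ((scaleSize κ k).choose j : ℝ) * r ^ j * (1 - r) ^ (scaleSize κ k - j) := by
  classical
  open Polynomial in
  have hgen : ∑ x : ι → Bool, C (prodWeight (bern q) x) * X ^ scaleNum κ k x =
      (C r * X + C (1 - r)) ^ scaleSize κ k := by
    have h1 : ∀ x : ι → Bool, C (prodWeight (bern q) x) * X ^ scaleNum κ k x =
        ∏ i, (C (bern q i (x i)) * if κ i = k ∧ x i = true then X else 1) := by
      intro x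
      rw [prod_mul_distrib, prod_ite, prod_const, prod_const_one, mul_one, prodWeight, map_prod]
      rfl
    simp_rw [h1]
    rw [← Fintype.prod_sum fun i b => C (bern q i b) * if κ i = k ∧ b = true then X else (1 : ℝ[X])]
    have h2 : ∀ i, (∑ b, C (bern q i b) * if κ i = k ∧ b = true then X else (1 : ℝ[X])) =
        if κ i = k then C r * X + C (1 - r) else 1 := by
      intro i
      by_cases hi : κ i = k
      · simp [hi, bern, hq i hi]
      · simp [hi, bern]
    simp_rw [h2]
    rw [prod_ite, prod_const, prod_const_one, mul_one]
    rfl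
  have hc := congrArg (fun p => Polynomial.coeff p j) hgen
  simp only [Polynomial.finsetSum_coeff, Polynomial.coeff_C_mul_X_pow] at hc
  rw [prodProb, sum_filter]
  calc _ = ∑ x : ι → Bool, if j = scaleNum κ k x then prodWeight (bern q) x else 0 := by
        simp only [eq_comm]
    _ = _ := by
        rw [hc, add_pow, Polynomial.finsetSum_coeff]
        have h3 : ∀ m, ((Polynomial.C r * Polynomial.X) ^ m *
            Polynomial.C (1 - r) ^ (scaleSize κ k - m) *
              (((scaleSize κ k).choose m : ℕ) : Polynomial ℝ)).coeff j =
            if j = m then ((scaleSize κ k).choose m : ℝ) * r ^ m *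
              (1 - r) ^ (scaleSize κ k - m) else 0 := by
          intro m
          have : (Polynomial.C r * Polynomial.X) ^ m *
            Polynomial.C (1 - r) ^ (scaleSize κ k - m) *
              (((scaleSize κ k).choose m : ℕ) : Polynomial ℝ) =
              Polynomial.C (((scaleSize κ k).choose m : ℝ) * r ^ m *
                (1 - r) ^ (scaleSize κ k - m)) * Polynomial.X ^ m := by
            simp only [map_mul, map_pow, mul_pow, map_natCast]
            ring
          rw [this, Polynomial.coeff_C_mul_X_pow]
        simp_rw [h3]
        rw [sum_ite_eq]
        split_ifs with h
        · rfl
        · rw [Nat.choose_eq_zero_of_lt (by simpa [Nat.lt_succ_iff] using h)]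
          simp

theorem prodProb_forall_scaleNum_eq (κ : ι → ℕ) (q : ι → ℝ) (m : ℕ → ℕ) (s : Finset ℕ) :
    prodProb (bern q) (fun x => ∀ k ∈ s, scaleNum κ k x = m k) =
      ∏ k ∈ s, prodProb (bern q) (fun x => scaleNum κ k x = m k) := by
  induction s using Finset.induction_on with
  | empty => simpa [prodProb] using sum_prodWeight (sum_bern q)
  | insert a s ha ih =>
    rw [prod_insert ha, ← ih, ← prodProb_and_eq_mul (sum_bern q) (fun i => κ i = a)]
    · simp only [mem_insert, forall_eq_or_imp]
    · intro x y hxy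
      have : scaleNum κ a x = scaleNum κ a y := by
        unfold scaleNum
        congr 1
        ext i
        simp only [mem_filter, mem_univ, true_and]
        exact and_congr_right fun hi => by rw [hxy i hi]
      rw [this]
    · intro x y hxy
      refine forall₂_congr fun k hk => ?_
      have : scaleNum κ k x = scaleNum κ k y := by
        unfold scaleNum
        congr 1
        ext i
        simp only [mem_filter, mem_univ, true_and]
        exact and_congr_right fun hi => by rw [hxy i (by rintro rfl; exact ha (hi ▸ hk))]
      rw [this]

end Scales

/-- A binomial variable with success probability at most `1/2` attains the integer part of its mean
with probability at least `1 / (2 (N + 1))`: that value or the next one is the mode. -/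
theorem binomial_floor_mean_ge {N : ℕ} {q : ℝ} (h0 : 0 ≤ q) (h2 : q ≤ 1 / 2) :
    1 / (2 * ((N : ℝ) + 1)) ≤
      (N.choose ⌊N * q⌋₊ : ℝ) * q ^ ⌊N * q⌋₊ * (1 - q) ^ (N - ⌊N * q⌋₊) := by
  set b : ℕ → ℝ := fun j => (N.choose j : ℝ) * q ^ j * (1 - q) ^ (N - j) with hb
  set m := ⌊N * q⌋₊ with hm
  have hb0 : ∀ j, 0 ≤ b j := fun j => by
    have : 0 ≤ 1 - q := by linarith
    positivity
  have hm1 : (m : ℝ) ≤ N * q := Nat.floor_le (by positivity)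
  have hm2 : (N : ℝ) * q < m + 1 := Nat.lt_floor_add_one _
  have hstep : ∀ j, j < N → b (j + 1) * ((j + 1) * (1 - q)) = b j * ((N - j) * q) := by
    intro j hj
    have hc : (N.choose (j + 1) : ℝ) * (j + 1) = N.choose j * (N - j) := by
      have := Nat.choose_succ_right_eq N j
      rw [← Nat.cast_sub hj.le]
      exact_mod_cast this
    have hs : N - j = (N - (j + 1)) + 1 := by omega
    simp only [hb]
    rw [hs, pow_succ, pow_succ]
    calc _ = ((N.choose (j + 1) : ℝ) * (j + 1)) * (q ^ j * q * (1 - q) ^ (N - (j + 1)) * (1 - q)) := by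
          ring
      _ = _ := by
          rw [hc]
          ring
  have hlow : ∀ d, d ≤ m → b (m - d) ≤ b m := by
    intro d
    induction d with
    | zero => intro _; simp
    | succ d ih =>
      intro hd
      refine le_trans ?_ (ih (by omega))
      obtain ⟨j, hj⟩ : ∃ j, m - (d + 1) = j := ⟨_, rfl⟩
      have hj' : m - d = j + 1 := by omega
      rw [hj, hj']
      have hjm : (j : ℝ) + 1 ≤ m := by
        have : j + 1 ≤ m := by omega
        exact_mod_cast this
      have hjN : j < N := by
        have : (j : ℝ) < N := by nlinarith [Nat.cast_nonneg (α := ℝ) N]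
        exact_mod_cast this
      have := hstep j hjN
      have hpos : 0 < ((j : ℝ) + 1) * (1 - q) := by
        have : 0 < 1 - q := by linarith
        positivity
      refine le_of_mul_le_mul_right ?_ hpos
      rw [this]
      refine mul_le_mul_of_nonneg_left ?_ (hb0 j)
      nlinarith
  have hhigh : ∀ d, b (m + 1 + d) ≤ b (m + 1) := by
    intro d
    induction d with
    | zero => simp
    | succ d ih =>
      refine le_trans ?_ ih
      by_cases hN : m + 1 + d < N
      · have := hstep _ hN
        push_cast at this
        have hpos : 0 < ((m : ℝ) + 1 + d + 1) * (1 - q) := by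
          have : 0 < 1 - q := by linarith
          positivity
        refine le_of_mul_le_mul_right ?_ hpos
        rw [← add_assoc, this]
        refine mul_le_mul_of_nonneg_left ?_ (hb0 _)
        nlinarith [Nat.cast_nonneg (α := ℝ) d]
      · have : N.choose (m + 1 + (d + 1)) = 0 := Nat.choose_eq_zero_of_lt (by omega)
        have h0 : b (m + 1 + (d + 1)) = 0 := by simp [hb, this]
        rw [h0]
        exact hb0 _
  have hmid : b (m + 1) ≤ 2 * b m := by
    by_cases hN : m < N
    · have := hstep m hN
      have hpos : 0 < ((m : ℝ) + 1) * (1 - q) := by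
        have : 0 < 1 - q := by linarith
        positivity
      refine le_of_mul_le_mul_right ?_ hpos
      rw [this, show ∀ z, 2 * b m * z = b m * (2 * z) from fun z => by ring]
      refine mul_le_mul_of_nonneg_left ?_ (hb0 _)
      nlinarith
    · have : N.choose (m + 1) = 0 := Nat.choose_eq_zero_of_lt (by omega)
      have h0 : b (m + 1) = 0 := by simp [hb, this]
      rw [h0]
      linarith [hb0 m]
  have hall : ∀ j, b j ≤ 2 * b m := by
    intro j
    rcases le_or_gt j m with h | h
    · have := hlow (m - j) (by omega)
      rw [show m - (m - j) = j by omega] at this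
      linarith [hb0 m]
    · have := hhigh (j - (m + 1))
      rw [show m + 1 + (j - (m + 1)) = j by omega] at this
      linarith
  have hsum : ∑ j ∈ range (N + 1), b j = 1 := by
    have := add_pow q (1 - q) N
    rw [show q + (1 - q) = 1 by ring, one_pow] at this
    rw [this]
    exact sum_congr rfl fun j _ => by simp only [hb]; ring
  have h1 : (1 : ℝ) ≤ (N + 1) * (2 * b m) := by
    have := sum_le_sum (s := range (N + 1)) fun j _ => hall j
    rw [hsum, sum_const, card_range, nsmul_eq_mul] at this
    exact_mod_cast this
  rw [div_le_iff₀ (by positivity)]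
  change (1 : ℝ) ≤ b m * (2 * (N + 1))
  linarith

section ChangeOfMeasure

variable {ι : Type*} [Fintype ι]

theorem prodWeight_gibbs (c : ι → ℝ) (l : ℝ) (x : ι → Bool) :
    prodWeight (bern fun i => 1 / (1 + Real.exp (l * c i))) x =
      (∏ i, (1 + Real.exp (-(l * c i)))⁻¹) * Real.exp (-(l * configCost c x)) := by
  rw [configCost, mul_sum, ← sum_neg_distrib, Real.exp_sum, ← prod_mul_distrib]
  refine prod_congr rfl fun i _ => ?_
  have h1 : Real.exp (l * c i) ≠ 0 := (Real.exp_pos _).ne'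
  have h2 : 1 + Real.exp (l * c i) ≠ 0 := by positivity
  cases x i
  · simp only [bern, Bool.false_eq_true, if_false, mul_zero, neg_zero, Real.exp_zero, Real.exp_neg]
    field_simp
    ring
  · simp only [bern, if_true, Real.exp_neg]
    field_simp
    ring

variable [DecidableEq ι]

/-- The uniform measure on the configurations of bounded cost is dominated by the Gibbs measure
whose mean cost equals the bound, up to a factor that is the product of a polynomial factor for
each scale and of the price of rounding the mean number of coordinates in each scale to an
integer: the rounded means form a profile of admissible cost, whose Gibbs probability is not too
small and whose class has an almost maximal Gibbs mass per configuration. -/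
theorem card_bounded_cost_le {κ : ι → ℕ} {K : ℕ} (hκ : ∀ i, κ i ≤ K) {w : ℕ → ℝ}
    (hw : ∀ k, 0 ≤ w k) {l M : ℝ} (hl : 0 ≤ l)
    (hM : ∑ i, 1 / (1 + Real.exp (l * w (κ i))) * w (κ i) = M) (P : (ι → Bool) → Prop)
    [DecidablePred P] :
    (#{x | configCost (fun i => w (κ i)) x ≤ M ∧ P x} : ℝ) ≤
      ((∏ k ∈ range (K + 1), (2 * ((scaleSize κ k : ℝ) + 1))) *
        Real.exp (l * ∑ k ∈ range (K + 1), w k)) *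
      #{x | configCost (fun i => w (κ i)) x ≤ M} *
      prodProb (bern fun i => 1 / (1 + Real.exp (l * w (κ i)))) P := by
  classical
  set c : ι → ℝ := fun i => w (κ i) with hc
  set q : ι → ℝ := fun i => 1 / (1 + Real.exp (l * w (κ i))) with hq
  set r : ℕ → ℝ := fun k => 1 / (1 + Real.exp (l * w k)) with hr
  have hr0 : ∀ k, 0 ≤ r k := fun k => by positivity
  have hr2 : ∀ k, r k ≤ 1 / 2 := fun k => by
    have := Real.one_le_exp (mul_nonneg hl (hw k))
    simp only [hr]
    gcongr
    linarith
  have hqn : ∀ i b, 0 ≤ bern q i b :=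
    bern_nonneg (fun i => hr0 _) fun i => (hr2 (κ i)).trans (by norm_num)
  set D := ∏ i, (1 + Real.exp (-(l * c i)))⁻¹ with hD
  have hDpos : 0 < D := prod_pos fun i _ => by positivity
  have hwt : ∀ x, prodWeight (bern q) x = D * Real.exp (-(l * configCost c x)) :=
    prodWeight_gibbs c l
  have hup : (#{x | configCost c x ≤ M ∧ P x} : ℝ) * (D * Real.exp (-(l * M))) ≤
      prodProb (bern q) P := by
    calc (#{x | configCost c x ≤ M ∧ P x} : ℝ) * (D * Real.exp (-(l * M)))
        = ∑ x with configCost c x ≤ M ∧ P x, D * Real.exp (-(l * M)) := by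
          rw [sum_const, nsmul_eq_mul]
      _ ≤ ∑ x with configCost c x ≤ M ∧ P x, prodWeight (bern q) x := by
          refine sum_le_sum fun x hx => ?_
          rw [hwt]
          have := (mem_filter.mp hx).2.1
          gcongr
      _ ≤ prodProb (bern q) P := by
          refine sum_le_sum_of_subset_of_nonneg (fun x hx => ?_) fun x _ _ =>
            prodWeight_nonneg hqn x
          simp only [mem_filter, mem_univ, true_and] at hx ⊢
          exact hx.2
  set m : ℕ → ℕ := fun k => ⌊(scaleSize κ k : ℝ) * r k⌋₊ with hm
  have hMr : ∑ k ∈ range (K + 1), (scaleSize κ k : ℝ) * (r k * w k) = M := by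
    rw [← hM, ← sum_eq_sum_scaleSize hκ fun k => r k * w k]
  have hcost : ∀ x, (∀ k ∈ range (K + 1), scaleNum κ k x = m k) →
      configCost c x ≤ M ∧ M - ∑ k ∈ range (K + 1), w k ≤ configCost c x := by
    intro x hx
    rw [hc, configCost_eq_sum_scaleNum hκ w x, ← hMr, ← sum_sub_distrib]
    constructor
    · refine sum_le_sum fun k hk => ?_
      rw [hx k hk, ← mul_assoc]
      exact mul_le_mul_of_nonneg_right (Nat.floor_le (mul_nonneg (Nat.cast_nonneg _) (hr0 k)))
        (hw k)
    · refine sum_le_sum fun k hk => ?_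
      rw [hx k hk]
      have := Nat.lt_floor_add_one ((scaleSize κ k : ℝ) * r k)
      nlinarith [hw k]
  have hlow : (∏ k ∈ range (K + 1), (2 * ((scaleSize κ k : ℝ) + 1)))⁻¹ ≤
      #{x | configCost c x ≤ M} *
        (D * (Real.exp (-(l * M)) * Real.exp (l * ∑ k ∈ range (K + 1), w k))) := by
    calc (∏ k ∈ range (K + 1), (2 * ((scaleSize κ k : ℝ) + 1)))⁻¹
        ≤ prodProb (bern q) (fun x => ∀ k ∈ range (K + 1), scaleNum κ k x = m k) := by
          rw [prodProb_forall_scaleNum_eq, ← prod_inv_distrib]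
          refine prod_le_prod (fun k _ => by positivity) fun k _ => ?_
          rw [prodProb_scaleNum_eq (r := r k) fun i hi => by simp only [hq, hr, hi]]
          rw [← one_div]
          exact binomial_floor_mean_ge (hr0 k) (hr2 k)
      _ ≤ ∑ x with configCost c x ≤ M,
          D * (Real.exp (-(l * M)) * Real.exp (l * ∑ k ∈ range (K + 1), w k)) := by
          rw [prodProb, sum_filter, sum_filter]
          refine sum_le_sum fun x _ => ?_
          split_ifs with h1 h2 h2
          · rw [hwt, ← Real.exp_add]
            have := (hcost x h1).2
            gcongr
            nlinarith
          · exact absurd (hcost x h1).1 h2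
          · positivity
          · exact le_rfl
      _ = _ := by rw [sum_const, nsmul_eq_mul]
  have hPi : 0 < ∏ k ∈ range (K + 1), (2 * ((scaleSize κ k : ℝ) + 1)) :=
    prod_pos fun k _ => by positivity
  rw [inv_le_iff_one_le_mul₀' hPi] at hlow
  have hE : 0 < D * Real.exp (-(l * M)) := by positivity
  refine le_of_mul_le_mul_right ?_ hE
  refine hup.trans ?_
  calc prodProb (bern q) P = 1 * prodProb (bern q) P := (one_mul _).symm
    _ ≤ _ := mul_le_mul_of_nonneg_right hlow (prodProb_nonneg hqn P)
    _ = _ := by ring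

end ChangeOfMeasure

/-! ### Couplings of exchangeable laws -/

section Coupling

variable {Ω α ι : Type*} [Fintype Ω] [Fintype α] [DecidableEq α]

/-- The law of the random variable `X` on the finite space `Ω` with masses `p`. -/
def pushLaw (p : Ω → ℝ) (X : Ω → α) (x : α) : ℝ := ∑ ω, if X ω = x then p ω else 0

/-- The joint law of three random variables. -/
def jointLaw (p : Ω → ℝ) (X Y Z : Ω → α) (x y z : α) : ℝ :=
  ∑ ω, if X ω = x ∧ Y ω = y ∧ Z ω = z then p ω else 0

theorem sum_jointLaw_fst (p : Ω → ℝ) (X Y Z : Ω → α) (x : α) :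
    ∑ y, ∑ z, jointLaw p X Y Z x y z = pushLaw p X x := by
  simp only [jointLaw, pushLaw, ite_and]
  simp_rw [sum_comm (s := (univ : Finset α)) (t := (univ : Finset Ω))]
  refine sum_congr rfl fun ω _ => ?_
  by_cases h : X ω = x <;> simp [h]

theorem sum_jointLaw_snd (p : Ω → ℝ) (X Y Z : Ω → α) (y : α) :
    ∑ x, ∑ z, jointLaw p X Y Z x y z = pushLaw p Y y := by
  simp only [jointLaw, pushLaw, ite_and]
  simp_rw [sum_comm (s := (univ : Finset α)) (t := (univ : Finset Ω))]
  refine sum_congr rfl fun ω _ => ?_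
  by_cases h : Y ω = y <;> simp [h]

theorem sum_jointLaw_trd (p : Ω → ℝ) (X Y Z : Ω → α) (z : α) :
    ∑ x, ∑ y, jointLaw p X Y Z x y z = pushLaw p Z z := by
  simp only [jointLaw, pushLaw, ite_and]
  simp_rw [sum_comm (s := (univ : Finset α)) (t := (univ : Finset Ω))]
  refine sum_congr rfl fun ω _ => ?_
  by_cases h : Z ω = z <;> simp [h]

theorem sum_jointLaw_filter (p : Ω → ℝ) (X Y Z : Ω → α) (R : α → α → α → Prop)
    [∀ x y z, Decidable (R x y z)] :
    ∑ x, ∑ y, ∑ z, (if R x y z then jointLaw p X Y Z x y z else 0) =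
      ∑ ω, if R (X ω) (Y ω) (Z ω) then p ω else 0 := by
  have : ∀ x y z, (if R x y z then jointLaw p X Y Z x y z else 0) =
      ∑ ω, if X ω = x then if Y ω = y then if Z ω = z then
        if R (X ω) (Y ω) (Z ω) then p ω else 0 else 0 else 0 else 0 := by
    intro x y z
    rw [jointLaw, ← sum_const_zero (s := (univ : Finset Ω)), ← Finset.sum_ite_irrel]
    refine sum_congr rfl fun ω _ => ?_
    by_cases h1 : X ω = x <;> by_cases h2 : Y ω = y <;> by_cases h3 : Z ω = z <;>
      simp [h1, h2, h3]
  simp_rw [this, sum_comm (s := (univ : Finset α)) (t := (univ : Finset Ω))]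
  simp

end Coupling

section Exchangeable

variable {ι : Type*} [Fintype ι]

/-- The rank of a coordinate in an enumeration of its scale. -/
noncomputable def scaleRank (κ : ι → ℕ) (i : ι) : ℕ :=
  (Fintype.equivFin {j // κ j = κ i} ⟨i, rfl⟩ : ℕ)

/-- The configuration in which the first `m k` coordinates of every scale `k` are `true`. -/
noncomputable def sortedConfig (κ : ι → ℕ) (m : ℕ → ℕ) (i : ι) : Bool :=
  decide (scaleRank κ i < m (κ i))

theorem scaleNum_sortedConfig (κ : ι → ℕ) {m : ℕ → ℕ} {k : ℕ} (hm : m k ≤ scaleSize κ k) :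
    scaleNum κ k (sortedConfig κ m) = m k := by
  classical
  have hcard : Fintype.card {j // κ j = k} = scaleSize κ k := Fintype.card_subtype _
  have hrank : ∀ j : {j // κ j = k}, scaleRank κ j = (Fintype.equivFin {j // κ j = k} j : ℕ) := by
    rintro ⟨j, rfl⟩
    rfl
  have h1 : scaleNum κ k (sortedConfig κ m) =
      #{j : {j // κ j = k} | (Fintype.equivFin {j // κ j = k} j : ℕ) < m k} := by
    rw [scaleNum, ← card_map (Function.Embedding.subtype _)]
    congr 1
    ext i
    simp only [mem_filter, mem_univ, true_and, sortedConfig, decide_eq_true_eq, Finset.mem_map,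
      Function.Embedding.subtype_apply, Subtype.exists, exists_and_right, exists_eq_right]
    constructor
    · rintro ⟨hi, h⟩
      refine ⟨hi, ?_⟩
      rw [← hrank ⟨i, hi⟩, ← congrArg m hi]
      exact h
    · rintro ⟨hi, h⟩
      refine ⟨hi, ?_⟩
      rw [← hrank ⟨i, hi⟩, ← congrArg m hi] at h
      exact h
  rw [h1, ← card_map (Fintype.equivFin {j // κ j = k}).toEmbedding]
  have h2 : ((univ.filter fun j : {j // κ j = k} =>
      (Fintype.equivFin {j // κ j = k} j : ℕ) < m k).map
        (Fintype.equivFin {j // κ j = k}).toEmbedding) =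
      univ.filter fun a : Fin (Fintype.card {j // κ j = k}) => (a : ℕ) < m k := by
    ext a
    simp only [mem_map_equiv, mem_filter, mem_univ, true_and, Equiv.apply_symm_apply]
  rw [h2, Fin.card_filter_val_lt, hcard]
  exact min_eq_right hm

/-- Configurations with the same number of `true` coordinates in each scale differ by a permutation
within the scales. -/
theorem exists_perm_of_scaleNum_eq {κ : ι → ℕ} {x y : ι → Bool}
    (h : ∀ k, scaleNum κ k x = scaleNum κ k y) :
    ∃ σ : Equiv.Perm ι, (∀ i, κ (σ i) = κ i) ∧ y ∘ σ = x := by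
  classical
  have hfalse : ∀ (k : ℕ) (z : ι → Bool),
      scaleNum κ k z + #{i | κ i = k ∧ z i = false} = scaleSize κ k := by
    intro k z
    rw [scaleNum, scaleSize, ← card_filter_add_card_filter_not (s := {i | κ i = k})
      (fun i => z i = true), filter_filter, filter_filter]
    simp only [Bool.not_eq_true]
  have hfib : ∀ c : ℕ × Bool,
      Nonempty ({i // (κ i, x i) = c} ≃ {i // (κ i, y i) = c}) := by
    rintro ⟨k, b⟩
    rw [← Fintype.card_eq, Fintype.card_subtype, Fintype.card_subtype]
    simp only [Prod.mk.injEq]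
    cases b
    · have h1 := hfalse k x
      have h2 := hfalse k y
      have h3 := h k
      omega
    · exact h k
  let e := Equiv.ofFiberEquiv fun c => (hfib c).some
  have he : ∀ i, (κ (e i), y (e i)) = (κ i, x i) := fun i =>
    Equiv.ofFiberEquiv_map (f := fun i => (κ i, x i)) (g := fun i => (κ i, y i))
      (fun c => (hfib c).some) i
  exact ⟨e, fun i => congrArg Prod.fst (he i), funext fun i => congrArg Prod.snd (he i)⟩

variable [DecidableEq ι]

open Classical in
/-- Three random configurations whose laws are invariant under permutations within the scales can
be recoupled so that they are nested whenever their numbers of `true` coordinates are nested in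
each scale. Each configuration is replaced by the sorted one of the same profile, and a common
uniformly random permutation within the scales is then applied, which restores the laws. -/
theorem exists_nested_coupling {Ω : Type*} [Fintype Ω] (κ : ι → ℕ) {p : Ω → ℝ}
    (hp : ∀ ω, 0 ≤ p ω) (X Y Z : Ω → ι → Bool)
    (hX : ∀ σ : Equiv.Perm ι, (∀ i, κ (σ i) = κ i) → ∀ x, pushLaw p X (x ∘ σ) = pushLaw p X x)
    (hY : ∀ σ : Equiv.Perm ι, (∀ i, κ (σ i) = κ i) → ∀ x, pushLaw p Y (x ∘ σ) = pushLaw p Y x)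
    (hZ : ∀ σ : Equiv.Perm ι, (∀ i, κ (σ i) = κ i) → ∀ x, pushLaw p Z (x ∘ σ) = pushLaw p Z x) :
    ∃ w : (ι → Bool) → (ι → Bool) → (ι → Bool) → ℝ,
      (∀ x y z, 0 ≤ w x y z) ∧
      (∀ x, ∑ y, ∑ z, w x y z = pushLaw p X x) ∧
      (∀ y, ∑ x, ∑ z, w x y z = pushLaw p Y y) ∧
      (∀ z, ∑ x, ∑ y, w x y z = pushLaw p Z z) ∧
      (∑ ω, if ∀ k, scaleNum κ k (X ω) ≤ scaleNum κ k (Y ω) ∧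
          scaleNum κ k (Y ω) ≤ scaleNum κ k (Z ω) then p ω else 0) ≤
        ∑ x, ∑ y, ∑ z, if x ≤ y ∧ y ≤ z then w x y z else 0 := by
  let 𝒢 := {σ : Equiv.Perm ι // ∀ i, κ (σ i) = κ i}
  have : Nonempty 𝒢 := ⟨⟨1, fun i => rfl⟩⟩
  have hcard : (0 : ℝ) < Fintype.card 𝒢 := by exact_mod_cast Fintype.card_pos
  let p' : Ω × 𝒢 → ℝ := fun a => p a.1 / Fintype.card 𝒢
  let sym : (Ω → ι → Bool) → Ω × 𝒢 → ι → Bool := fun X a =>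
    sortedConfig κ (fun k => scaleNum κ k (X a.1)) ∘ a.2.1
  have hlaw : ∀ X : Ω → ι → Bool,
      (∀ σ : Equiv.Perm ι, (∀ i, κ (σ i) = κ i) → ∀ x, pushLaw p X (x ∘ σ) = pushLaw p X x) →
      ∀ x, pushLaw p' (sym X) x = pushLaw p X x := by
    intro X hX x
    -- For a fixed sample, the sorted configuration lies in the orbit of the sampled one.
    have h1 : ∀ ω, (∑ σ : 𝒢, if sym X (ω, σ) = x then p' (ω, σ) else 0) =
        ∑ σ : 𝒢, if X ω ∘ σ.1 = x then p ω / Fintype.card 𝒢 else 0 := by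
      intro ω
      obtain ⟨τ, hτ, hτ'⟩ := exists_perm_of_scaleNum_eq (κ := κ) (x := X ω)
        (y := sortedConfig κ fun k => scaleNum κ k (X ω))
        fun k => (scaleNum_sortedConfig κ (m := fun k => scaleNum κ k (X ω))
          (scaleNum_le_scaleSize κ k _)).symm
      have hτi : ∀ i, κ (τ⁻¹ i) = κ i := fun i => by
        rw [← hτ (τ⁻¹ i)]
        simp
      let e : 𝒢 ≃ 𝒢 :=
        { toFun := fun σ => ⟨τ * σ.1, fun i => (hτ _).trans (σ.2 i)⟩
          invFun := fun σ => ⟨τ⁻¹ * σ.1, fun i => (hτi _).trans (σ.2 i)⟩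
          left_inv := fun σ => by ext; simp
          right_inv := fun σ => by ext; simp }
      rw [← Equiv.sum_comp e]
      refine sum_congr rfl fun σ _ => ?_
      have : sym X (ω, e σ) = X ω ∘ σ.1 := by
        rw [← hτ']
        rfl
      rw [this]
    rw [pushLaw, Fintype.sum_prod_type]
    simp_rw [h1]
    rw [sum_comm]
    have h2 : ∀ σ : 𝒢, (∑ ω, if X ω ∘ σ.1 = x then p ω / Fintype.card 𝒢 else 0) =
        pushLaw p X x / Fintype.card 𝒢 := by
      intro σ
      have hσ : ∀ i, κ (σ.1⁻¹ i) = κ i := fun i => by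
        rw [← σ.2 (σ.1⁻¹ i)]
        simp
      rw [← hX _ hσ x, pushLaw, sum_div]
      refine sum_congr rfl fun ω _ => ?_
      have : X ω ∘ σ.1 = x ↔ X ω = x ∘ (σ.1⁻¹ : Equiv.Perm ι) := by
        constructor
        · rintro rfl
          ext i
          simp
        · intro h
          rw [h]
          ext i
          simp
      simp only [this]
      split_ifs <;> simp
    rw [sum_congr rfl fun σ _ => h2 σ, sum_const, card_univ, nsmul_eq_mul]
    field_simp
  refine ⟨jointLaw p' (sym X) (sym Y) (sym Z), fun x y z => sum_nonneg fun a _ => ?_, fun x => ?_,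
    fun y => ?_, fun z => ?_, ?_⟩
  · split_ifs
    · exact div_nonneg (hp _) hcard.le
    · exact le_rfl
  · rw [sum_jointLaw_fst, hlaw X hX]
  · rw [sum_jointLaw_snd, hlaw Y hY]
  · rw [sum_jointLaw_trd, hlaw Z hZ]
  · rw [sum_jointLaw_filter p' (sym X) (sym Y) (sym Z) fun x y z => x ≤ y ∧ y ≤ z,
      Fintype.sum_prod_type]
    refine sum_le_sum fun ω _ => ?_
    have hmono : ∀ m m' : ℕ → ℕ, (∀ k, m k ≤ m' k) → ∀ σ : 𝒢,
        sortedConfig κ m ∘ σ.1 ≤ sortedConfig κ m' ∘ σ.1 := by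
      intro m m' h σ i
      simp only [Function.comp_apply, sortedConfig]
      exact Bool.le_iff_imp.mpr fun h1 => by
        simp only [decide_eq_true_eq] at h1 ⊢
        exact h1.trans_le (h _)
    split_ifs with h
    · have : ∀ σ : 𝒢, (if sym X (ω, σ) ≤ sym Y (ω, σ) ∧ sym Y (ω, σ) ≤ sym Z (ω, σ)
          then p' (ω, σ) else 0) = p ω / Fintype.card 𝒢 := fun σ =>
        if_pos ⟨hmono _ _ (fun k => (h k).1) σ, hmono _ _ (fun k => (h k).2) σ⟩
      rw [sum_congr rfl fun σ _ => this σ, sum_const, card_univ, nsmul_eq_mul]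
      field_simp
      exact le_rfl
    · refine sum_nonneg fun σ _ => ?_
      split_ifs
      · exact div_nonneg (hp _) hcard.le
      · exact le_rfl

end Exchangeable

/-! ### Sandwiching the uniform measure on configurations of bounded cost -/

section Sandwich

variable {ι : Type*} [Fintype ι] [DecidableEq ι]

theorem prodProb_map {β δ : Type*} [Fintype β] [Fintype δ] [DecidableEq δ] {ω : ι → β → ℝ}
    {ω' : ι → δ → ℝ} (φ : β → δ) (h : ∀ i d, (∑ b, if φ b = d then ω i b else 0) = ω' i d)
    (P : (ι → δ) → Prop) : prodProb ω (fun x => P fun i => φ (x i)) = prodProb ω' P := by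
  classical
  have h1 : ∀ y, prodWeight ω' y = ∑ x, if (fun i => φ (x i)) = y then prodWeight ω x else 0 := by
    intro y
    rw [sum_prodWeight_map]
    exact prod_congr rfl fun i _ => (h i (y i)).symm
  rw [prodProb, prodProb, sum_congr rfl fun y _ => h1 y, sum_comm, sum_filter]
  refine sum_congr rfl fun x _ => ?_
  rw [sum_ite_eq]
  simp

/-- Chernoff bounds for the number of `true` coordinates in a scale, at a distance of `ε / 2` times
a reference value `m` from the mean. -/
theorem prodProb_scaleNum_deviation_le {κ : ι → ℕ} {q : ι → ℝ} (h0 : ∀ i, 0 ≤ q i)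
    (h1 : ∀ i, q i ≤ 1) {k : ℕ} {v m b ε : ℝ} (hv : ∀ i, κ i = k → q i = v)
    (hm : (scaleSize κ k : ℝ) * v ≤ 2 * m) (hb : b ≤ m) (hε0 : 0 ≤ ε) (hε1 : ε ≤ 1) :
    prodProb (bern q) (fun x => ε / 2 * m ≤ scaleNum κ k x - scaleSize κ k * v) ≤
        Real.exp (-(ε ^ 2 * b / 32)) ∧
      prodProb (bern q) (fun x => ε / 2 * m ≤ scaleSize κ k * v - scaleNum κ k x) ≤
        Real.exp (-(ε ^ 2 * b / 32)) := by
  have hlin : ∀ (θ : ℝ) (x : ι → Bool),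
      ((∑ i, if x i then (if κ i = k then θ else 0) else 0) -
        ∑ i, q i * (if κ i = k then θ else 0)) = θ * (scaleNum κ k x - scaleSize κ k * v) := by
    intro θ x
    have e1 : (∑ i, if x i then (if κ i = k then θ else 0) else 0) = θ * scaleNum κ k x := by
      rw [scaleNum, card_filter, Nat.cast_sum, mul_sum]
      refine sum_congr rfl fun i _ => ?_
      by_cases hi : κ i = k <;> by_cases hx : x i <;> simp [hi, hx]
    have e2 : (∑ i, q i * (if κ i = k then θ else 0)) = θ * (scaleSize κ k * v) := by
      rw [scaleSize, card_filter, Nat.cast_sum, sum_mul, mul_sum]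
      refine sum_congr rfl fun i _ => ?_
      by_cases hi : κ i = k
      · simp [hi, hv i hi, mul_comm]
      · simp [hi]
    rw [e1, e2]
    ring
  have hsq : ∀ θ : ℝ, ∑ i, q i * (if κ i = k then θ else 0) ^ 2 = θ ^ 2 * (scaleSize κ k * v) := by
    intro θ
    rw [scaleSize, card_filter, Nat.cast_sum, sum_mul, mul_sum]
    refine sum_congr rfl fun i _ => ?_
    by_cases hi : κ i = k
    · simp [hi, hv i hi, mul_comm]
    · simp [hi]
  have hmain : ∀ θ : ℝ, |θ| = ε / 8 →
      prodProb (bern q) (fun x => ε / 8 * (ε / 2 * m) ≤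
        θ * (scaleNum κ k x - scaleSize κ k * v)) ≤ Real.exp (-(ε ^ 2 * b / 32)) := by
    intro θ hθ
    have := prodProb_linear_ge_le h0 h1 (fun i => if κ i = k then θ else 0)
      (fun i => by split_ifs <;> simp [hθ]; linarith) (ε / 8 * (ε / 2 * m))
    simp_rw [hlin, hsq] at this
    refine this.trans (Real.exp_le_exp.mpr ?_)
    have h2 : θ ^ 2 = (ε / 8) ^ 2 := by rw [← sq_abs, hθ]
    rw [h2]
    nlinarith [mul_le_mul_of_nonneg_left hm (sq_nonneg ε), mul_le_mul_of_nonneg_left hb (sq_nonneg ε)]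
  have h8 : 0 ≤ ε / 8 := by linarith
  constructor
  · refine (prodProb_mono (bern_nonneg h0 h1) fun x hx => ?_).trans (hmain (ε / 8) (abs_of_nonneg h8))
    exact mul_le_mul_of_nonneg_left hx h8
  · refine (prodProb_mono (bern_nonneg h0 h1) fun x hx => ?_).trans
      (hmain (-(ε / 8)) (by rw [abs_neg, abs_of_nonneg h8]))
    have := mul_le_mul_of_nonneg_left hx h8
    linarith

/-- The price of the change from the uniform measure on the configurations of bounded cost to the
Gibbs measure of parameter `l`. -/
noncomputable def tiltFactor (κ : ι → ℕ) (K : ℕ) (w : ℕ → ℝ) (l : ℝ) : ℝ :=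
  (∏ k ∈ range (K + 1), (2 * ((scaleSize κ k : ℝ) + 1))) *
    Real.exp (l * ∑ k ∈ range (K + 1), w k)

/-- The mass of `x` under the uniform measure on the configurations of cost at most `M`. -/
noncomputable def budgetMass (c : ι → ℝ) (M : ℝ) (x : ι → Bool) : ℝ :=
  if configCost c x ≤ M then 1 / (#{y | configCost c y ≤ M} : ℝ) else 0

theorem card_budget_pos {c : ι → ℝ} {M : ℝ} (hM : 0 ≤ M) :
    (0 : ℝ) < #{y : ι → Bool | configCost c y ≤ M} := by
  have : (fun _ => false) ∈ ({y | configCost c y ≤ M} : Finset (ι → Bool)) :=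
    mem_filter.mpr ⟨mem_univ _, by simp [configCost, hM]⟩
  exact_mod_cast card_pos.mpr ⟨_, this⟩

theorem sum_budgetMass {c : ι → ℝ} {M : ℝ} (hM : 0 ≤ M) : ∑ x, budgetMass c M x = 1 := by
  have := (card_budget_pos (c := c) hM).ne'
  simp only [budgetMass, ← sum_filter, sum_const, nsmul_eq_mul]
  field_simp

theorem budgetMass_nonneg (c : ι → ℝ) (M : ℝ) (x : ι → Bool) : 0 ≤ budgetMass c M x := by
  unfold budgetMass
  split_ifs <;> positivity

open Classical in
theorem sum_budgetMass_filter_le {κ : ι → ℕ} {K : ℕ} (hκ : ∀ i, κ i ≤ K) {w : ℕ → ℝ}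
    (hw : ∀ k, 0 ≤ w k) {l M : ℝ} (hl : 0 ≤ l)
    (hM : ∑ i, 1 / (1 + Real.exp (l * w (κ i))) * w (κ i) = M) (P : (ι → Bool) → Prop) :
    (∑ x, if P x then budgetMass (fun i => w (κ i)) M x else 0) ≤
      tiltFactor κ K w l * prodProb (bern fun i => 1 / (1 + Real.exp (l * w (κ i)))) P := by
  have hM0 : 0 ≤ M := hM ▸ sum_nonneg fun i _ => mul_nonneg (by positivity) (hw _)
  have hpos := card_budget_pos (c := fun i => w (κ i)) hM0
  have h := card_bounded_cost_le hκ hw hl hM P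
  have e : (∑ x, if P x then budgetMass (fun i => w (κ i)) M x else 0) =
      (#{x | configCost (fun i => w (κ i)) x ≤ M ∧ P x} : ℝ) /
        #{x | configCost (fun i => w (κ i)) x ≤ M} := by
    rw [card_filter, Nat.cast_sum, sum_div]
    refine sum_congr rfl fun x _ => ?_
    by_cases h1 : P x <;> by_cases h2 : configCost (fun i => w (κ i)) x ≤ M <;>
      simp [budgetMass, h1, h2]
  rw [e, div_le_iff₀ hpos]
  refine h.trans (le_of_eq ?_)
  rw [tiltFactor]
  ring

/-- The joint law of a coordinate in three nested Bernoulli configurations of marginals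
`(1 - ε) q`, `q` and `(1 + ε) q`: the value `j : Fin 4` means that the coordinate is `false` in
exactly `j` of the three, starting with the smallest one. -/
def thresholds (q : ι → ℝ) (ε : ℝ) (i : ι) : Fin 4 → ℝ :=
  ![(1 - ε) * q i, ε * q i, ε * q i, 1 - (1 + ε) * q i]

open Classical in
/-- The uniform measure on the configurations of bounded cost is sandwiched between two product
measures close to the Gibbs measure of the same mean cost. The coordinates of scale `0` cost
nothing, hence are independent fair coins under the uniform measure too, and are coupled one by one;
in the other scales the numbers of `true` coordinates concentrate. -/
theorem exists_config_sandwich {κ : ι → ℕ} {K : ℕ} (hκ : ∀ i, κ i ≤ K) {w : ℕ → ℝ}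
    (hw : ∀ k, 0 ≤ w k) (hw0 : w 0 = 0) {l M : ℝ} (hl : 0 ≤ l)
    (hM : ∑ i, 1 / (1 + Real.exp (l * w (κ i))) * w (κ i) = M) {ε b : ℝ} (hε0 : 0 ≤ ε)
    (hε1 : ε ≤ 1)
    (hb : ∀ k, 1 ≤ k → k ≤ K → b ≤ scaleSize κ k * (1 / (1 + Real.exp (l * w k)))) :
    ∃ W : (ι → Bool) → (ι → Bool) → (ι → Bool) → ℝ,
      (∀ x y z, 0 ≤ W x y z) ∧
      (∀ x, ∑ y, ∑ z, W x y z =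
        prodWeight (bern fun i => (1 - ε) * (1 / (1 + Real.exp (l * w (κ i))))) x) ∧
      (∀ y, ∑ x, ∑ z, W x y z = budgetMass (fun i => w (κ i)) M y) ∧
      (∀ z, ∑ x, ∑ y, W x y z =
        prodWeight (bern fun i => (1 + ε) * (1 / (1 + Real.exp (l * w (κ i))))) z) ∧
      1 - K * (2 + 2 * tiltFactor κ K w l) * Real.exp (-(ε ^ 2 * b / 32)) ≤
        ∑ x, ∑ y, ∑ z, if x ≤ y ∧ y ≤ z then W x y z else 0 := by
  set c : ι → ℝ := fun i => w (κ i) with hc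
  set r : ℕ → ℝ := fun k => 1 / (1 + Real.exp (l * w k)) with hr
  set q : ι → ℝ := fun i => r (κ i) with hq
  have hM0 : 0 ≤ M := hM ▸ sum_nonneg fun i _ => mul_nonneg (by positivity) (hw _)
  have hr0 : ∀ k, 0 ≤ r k := fun k => by positivity
  have hr2 : ∀ k, r k ≤ 1 / 2 := fun k => by
    have := Real.one_le_exp (mul_nonneg hl (hw k))
    simp only [hr]
    gcongr
    linarith
  have hq0 : ∀ i, κ i = 0 → q i = 1 / 2 := fun i hi => by
    simp only [hq, hr, hi, hw0, mul_zero, Real.exp_zero]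
    norm_num
  set ω := thresholds q ε with hω
  have hωn : ∀ i j, 0 ≤ ω i j := by
    intro i j
    have h1 := hr0 (κ i)
    have h2 := hr2 (κ i)
    fin_cases j <;> simp only [hω, thresholds, hq] <;> simp <;> nlinarith
  have hω1 : ∀ i, ∑ j, ω i j = 1 := by
    intro i
    simp only [hω, thresholds, Fin.sum_univ_four]
    simp
    ring
  have hlowmap : ∀ i d, (∑ j, if decide (j = 0) = d then ω i j else 0) =
      bern (fun i => (1 - ε) * q i) i d := by
    intro i d
    cases d <;> simp [Fin.sum_univ_four, hω, thresholds, bern]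
    ring
  have hupmap : ∀ i d, (∑ j, if decide (j ≠ 3) = d then ω i j else 0) =
      bern (fun i => (1 + ε) * q i) i d := by
    intro i d
    cases d <;> simp [Fin.sum_univ_four, hω, thresholds, bern]
    ring
  have hmidmap : ∀ i, κ i = 0 → ∀ d, (∑ j, if decide (j ≤ 1) = d then ω i j else 0) = 1 / 2 := by
    intro i hi d
    have := hq0 i hi
    cases d
    · simp [Fin.sum_univ_four, hω, thresholds, this]
      ring
    · simp [Fin.sum_univ_four, hω, thresholds, this]
      ring
  let p : (ι → Fin 4) × (ι → Bool) → ℝ := fun a => prodWeight ω a.1 * budgetMass c M a.2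
  have hp : ∀ a, 0 ≤ p a := fun a => mul_nonneg (prodWeight_nonneg hωn _) (budgetMass_nonneg _ _ _)
  let X : (ι → Fin 4) × (ι → Bool) → ι → Bool := fun a i => decide (a.1 i = 0)
  let Y : (ι → Fin 4) × (ι → Bool) → ι → Bool := fun a i =>
    if κ i = 0 then decide (a.1 i ≤ 1) else a.2 i
  let Z : (ι → Fin 4) × (ι → Bool) → ι → Bool := fun a i => decide (a.1 i ≠ 3)
  have hfst : ∀ (T : (ι → Fin 4) → Prop) [DecidablePred T],
      (∑ a, if T a.1 then p a else 0) = prodProb ω T := by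
    intro T _
    rw [Fintype.sum_prod_type, prodProb, sum_filter]
    refine sum_congr rfl fun s _ => ?_
    by_cases hs : T s
    · simp only [hs, if_true, p]
      rw [← mul_sum, sum_budgetMass hM0, mul_one]
    · simp [hs]
  have hsnd : ∀ (T : (ι → Bool) → Prop),
      (∑ a, if T a.2 then p a else 0) = ∑ y, if T y then budgetMass c M y else 0 := by
    intro T
    rw [Fintype.sum_prod_type, sum_comm]
    refine sum_congr rfl fun y _ => ?_
    split_ifs
    · simp only [p]
      rw [← sum_mul, sum_prodWeight hω1, one_mul]
    · simp
  have hX : ∀ x, pushLaw p X x = prodWeight (bern fun i => (1 - ε) * q i) x := by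
    intro x
    have h1 := hfst fun s => (fun i => decide (s i = 0)) = x
    rw [pushLaw]
    refine h1.trans ?_
    have h2 := sum_prodWeight_map ω (fun j : Fin 4 => decide (j = 0)) x
    rw [prodProb, sum_filter]
    convert h2.trans (prod_congr rfl fun i _ => hlowmap i (x i))
    rfl
  have hZ : ∀ x, pushLaw p Z x = prodWeight (bern fun i => (1 + ε) * q i) x := by
    intro x
    have h1 := hfst fun s => (fun i => decide (s i ≠ 3)) = x
    rw [pushLaw]
    refine h1.trans ?_
    have h2 := sum_prodWeight_map ω (fun j : Fin 4 => decide (j ≠ 3)) x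
    rw [prodProb, sum_filter]
    convert h2.trans (prod_congr rfl fun i _ => hupmap i (x i))
    rfl
  have hcost : ∀ x y : ι → Bool, (∀ i, κ i ≠ 0 → x i = y i) → configCost c x = configCost c y := by
    intro x y hxy
    refine sum_congr rfl fun i _ => ?_
    by_cases hi : κ i = 0
    · simp [hc, hi, hw0]
    · rw [hxy i hi]
  have hY : ∀ x, pushLaw p Y x = budgetMass c M x := by
    intro x
    -- Coordinates of scale `0` contribute a factor `1/2` from the thresholds and a factor `2` from
    -- the two values at which the cost is the same.
    have h1 : ∀ s y, (if Y (s, y) = x then p (s, y) else 0) =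
        (prodWeight ω s * ∏ i, if κ i = 0 then (if decide (s i ≤ 1) = x i then 1 else 0) else 1) *
          (budgetMass c M x * ∏ i, if κ i = 0 then 1 else if y i = x i then 1 else 0) := by
      intro s y
      split_ifs with h
      · have h' : ∀ i, (if κ i = 0 then decide (s i ≤ 1) else y i) = x i := fun i => congrFun h i
        have e1 : (∏ i, if κ i = 0 then (if decide (s i ≤ 1) = x i then (1 : ℝ) else 0) else 1)
            = 1 := prod_eq_one fun i _ => by
          have := h' i
          split_ifs at this ⊢ <;> simp_all
        have e2 : (∏ i, if κ i = 0 then (1 : ℝ) else if y i = x i then 1 else 0) = 1 :=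
          prod_eq_one fun i _ => by
            have := h' i
            split_ifs at this ⊢ <;> simp_all
        have e3 : configCost c y = configCost c x := hcost _ _ fun i hi => by
          have := h' i
          rwa [if_neg hi] at this
        rw [e1, e2, mul_one, mul_one]
        simp only [p, budgetMass, e3]
      · obtain ⟨i, hi⟩ := Function.ne_iff.mp h
        change (if κ i = 0 then decide (s i ≤ 1) else y i) ≠ x i at hi
        by_cases h0 : κ i = 0
        · rw [if_pos h0] at hi
          have : (∏ i, if κ i = 0 then (if decide (s i ≤ 1) = x i then (1 : ℝ) else 0) else 1) = 0 :=
            prod_eq_zero (mem_univ i) (by rw [if_pos h0, if_neg hi])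
          rw [this]
          ring
        · rw [if_neg h0] at hi
          have : (∏ i, if κ i = 0 then (1 : ℝ) else if y i = x i then 1 else 0) = 0 :=
            prod_eq_zero (mem_univ i) (by rw [if_neg h0, if_neg hi])
          rw [this]
          ring
    rw [pushLaw, Fintype.sum_prod_type]
    simp_rw [h1]
    rw [← sum_mul_sum, ← mul_sum, sum_prodWeight_mul_prod ω fun i j =>
      if κ i = 0 then (if decide (j ≤ 1) = x i then (1 : ℝ) else 0) else 1,
      ← Fintype.prod_sum fun i b => if κ i = 0 then (1 : ℝ) else if b = x i then 1 else 0,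
      mul_left_comm, ← prod_mul_distrib, prod_eq_one, mul_one]
    intro i _
    by_cases h0 : κ i = 0
    · simp only [h0, if_true, mul_ite, mul_one, mul_zero]
      rw [hmidmap i h0 (x i)]
      simp
    · simp [h0, hω1 i]
  have hinvw : ∀ v : ℕ → ℝ, ∀ σ : Equiv.Perm ι, (∀ i, κ (σ i) = κ i) → ∀ x : ι → Bool,
      prodWeight (bern fun i => v (κ i)) (x ∘ σ) = prodWeight (bern fun i => v (κ i)) x := by
    intro v σ hσ x
    rw [prodWeight, prodWeight, ← Equiv.prod_comp σ fun i => bern (fun i => v (κ i)) i (x i)]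
    refine prod_congr rfl fun i _ => ?_
    simp [bern, hσ]
  have hinvb : ∀ σ : Equiv.Perm ι, (∀ i, κ (σ i) = κ i) → ∀ x : ι → Bool,
      budgetMass c M (x ∘ σ) = budgetMass c M x := by
    intro σ hσ x
    have : configCost c (x ∘ σ) = configCost c x := by
      rw [configCost, configCost, ← Equiv.sum_comp σ fun i => if x i then c i else 0]
      refine sum_congr rfl fun i _ => ?_
      simp [hc, hσ]
    rw [budgetMass, budgetMass, this]
  obtain ⟨W, hW0, hW1, hW2, hW3, hW4⟩ := exists_nested_coupling κ hp X Y Z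
    (fun σ hσ x => by rw [hX, hX]; exact hinvw (fun k => (1 - ε) * r k) σ hσ x)
    (fun σ hσ x => by rw [hY, hY]; exact hinvb σ hσ x)
    (fun σ hσ x => by rw [hZ, hZ]; exact hinvw (fun k => (1 + ε) * r k) σ hσ x)
  refine ⟨W, hW0, fun x => (hW1 x).trans (hX x), fun y => (hW2 y).trans (hY y),
    fun z => (hW3 z).trans (hZ z), le_trans ?_ hW4⟩
  -- The events that the three configurations leave their windows around the Gibbs means.
  let m : ℕ → ℝ := fun k => scaleSize κ k * r k
  have hm0 : ∀ k, 0 ≤ m k := fun k => mul_nonneg (Nat.cast_nonneg _) (hr0 k)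
  let badX : ℕ → (ι → Bool) → Prop := fun k x =>
    ε / 2 * m k ≤ scaleNum κ k x - scaleSize κ k * ((1 - ε) * r k)
  let badZ : ℕ → (ι → Bool) → Prop := fun k x =>
    ε / 2 * m k ≤ scaleSize κ k * ((1 + ε) * r k) - scaleNum κ k x
  let badU : ℕ → (ι → Bool) → Prop := fun k x =>
    ε / 2 * m k ≤ scaleNum κ k x - scaleSize κ k * r k
  let badL : ℕ → (ι → Bool) → Prop := fun k x =>
    ε / 2 * m k ≤ scaleSize κ k * r k - scaleNum κ k x
  set E := Real.exp (-(ε ^ 2 * b / 32)) with hE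
  have hsum : ∑ a, p a = 1 := by
    have := hfst fun _ => True
    simpa [prodProb, sum_prodWeight hω1] using this
  have hnest : ∀ a, (¬ ∀ k, scaleNum κ k (X a) ≤ scaleNum κ k (Y a) ∧
      scaleNum κ k (Y a) ≤ scaleNum κ k (Z a)) →
      (∃ k ∈ Icc 1 K, badX k (X a)) ∨ (∃ k ∈ Icc 1 K, badZ k (Z a)) ∨
      (∃ k ∈ Icc 1 K, badU k a.2) ∨ (∃ k ∈ Icc 1 K, badL k a.2) := by
    intro a h
    by_contra hbad
    simp only [not_or, not_exists, not_and] at hbad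
    obtain ⟨b1, b2, b3, b4⟩ := hbad
    refine h fun k => ?_
    rcases Nat.eq_zero_or_pos k with rfl | hk
    · constructor
      · refine card_le_card fun i hi => ?_
        simp only [mem_filter, mem_univ, true_and, X, Y, decide_eq_true_eq] at hi ⊢
        refine ⟨hi.1, ?_⟩
        rw [if_pos hi.1, hi.2]
        simp
      · refine card_le_card fun i hi => ?_
        simp only [mem_filter, mem_univ, true_and, Y, Z, decide_eq_true_eq] at hi ⊢
        refine ⟨hi.1, ?_⟩
        have h2 := hi.2
        rw [if_pos hi.1] at h2
        intro h3
        rw [h3] at h2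
        simp at h2
    rcases le_or_gt k K with hkK | hkK
    · have hk' : k ∈ Icc 1 K := mem_Icc.mpr ⟨hk, hkK⟩
      have hYk : scaleNum κ k (Y a) = scaleNum κ k a.2 := by
        unfold scaleNum
        congr 1
        ext i
        simp only [mem_filter, mem_univ, true_and, Y]
        refine and_congr_right fun hi => ?_
        rw [if_neg (by omega)]
      have c1 := b1 k hk'
      have c2 := b2 k hk'
      have c3 := b3 k hk'
      have c4 := b4 k hk'
      simp only [badX, badZ, badU, badL, m, not_le] at c1 c2 c3 c4
      rw [hYk]
      constructor
      · have : (scaleNum κ k (X a) : ℝ) ≤ scaleNum κ k a.2 := by linarith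
        exact_mod_cast this
      · have : (scaleNum κ k a.2 : ℝ) ≤ scaleNum κ k (Z a) := by linarith
        exact_mod_cast this
    · have : ∀ x, scaleNum κ k x = 0 := fun x => by
        rw [scaleNum, card_eq_zero, filter_eq_empty_iff]
        rintro i - ⟨hi, -⟩
        exact absurd (hκ i) (by omega)
      simp [this]
  have hrange : ∀ ρ : ℝ, 0 ≤ ρ → ρ ≤ 2 → (∀ i, 0 ≤ ρ * q i) ∧ ∀ i, ρ * q i ≤ 1 := by
    intro ρ h0 h2
    exact ⟨fun i => mul_nonneg h0 (hr0 _), fun i => by nlinarith [hr0 (κ i), hr2 (κ i)]⟩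
  have hdev : ∀ ρ : ℝ, 0 ≤ ρ → ρ ≤ 2 → ∀ k ∈ Icc 1 K,
      prodProb (bern fun i => ρ * q i)
          (fun x => ε / 2 * m k ≤ scaleNum κ k x - scaleSize κ k * (ρ * r k)) ≤ E ∧
        prodProb (bern fun i => ρ * q i)
          (fun x => ε / 2 * m k ≤ scaleSize κ k * (ρ * r k) - scaleNum κ k x) ≤ E := by
    intro ρ h0 h2 k hk
    rw [mem_Icc] at hk
    refine prodProb_scaleNum_deviation_le (hrange ρ h0 h2).1 (hrange ρ h0 h2).2
      (fun i hi => by simp only [hq, hi]) ?_ (hb k hk.1 hk.2) hε0 hε1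
    have := hm0 k
    simp only [m] at this ⊢
    nlinarith
  have hunion : ∀ (ρ : ℝ) (P : ℕ → (ι → Bool) → Prop), 0 ≤ ρ → ρ ≤ 2 →
      (∀ k ∈ Icc 1 K, prodProb (bern fun i => ρ * q i) (P k) ≤ E) →
      prodProb (bern fun i => ρ * q i) (fun x => ∃ k ∈ Icc 1 K, P k x) ≤ K * E := by
    intro ρ P h0 h2 hP
    refine (prodProb_exists_le (bern_nonneg (hrange ρ h0 h2).1 (hrange ρ h0 h2).2) _ _).trans ?_
    refine (sum_le_sum hP).trans (le_of_eq ?_)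
    simp
  have pX : (∑ a, if ∃ k ∈ Icc 1 K, badX k (X a) then p a else 0) ≤ K * E := by
    refine (hfst fun s => ∃ k ∈ Icc 1 K, badX k fun i => decide (s i = 0)).trans_le ?_
    rw [prodProb_map (ω := ω) (fun j : Fin 4 => decide (j = 0)) hlowmap
      fun x => ∃ k ∈ Icc 1 K, badX k x]
    exact hunion (1 - ε) badX (by linarith) (by linarith) fun k hk =>
      (hdev _ (by linarith) (by linarith) k hk).1
  have pZ : (∑ a, if ∃ k ∈ Icc 1 K, badZ k (Z a) then p a else 0) ≤ K * E := by
    refine (hfst fun s => ∃ k ∈ Icc 1 K, badZ k fun i => decide (s i ≠ 3)).trans_le ?_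
    rw [prodProb_map (ω := ω) (fun j : Fin 4 => decide (j ≠ 3)) hupmap
      fun x => ∃ k ∈ Icc 1 K, badZ k x]
    exact hunion (1 + ε) badZ (by linarith) (by linarith) fun k hk =>
      (hdev _ (by linarith) (by linarith) k hk).2
  have hT : 0 ≤ tiltFactor κ K w l :=
    mul_nonneg (prod_nonneg fun k _ => by positivity) (Real.exp_nonneg _)
  have pU : (∑ a, if ∃ k ∈ Icc 1 K, badU k a.2 then p a else 0) ≤ tiltFactor κ K w l * (K * E) := by
    refine (hsnd fun y => ∃ k ∈ Icc 1 K, badU k y).trans_le ?_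
    refine (sum_budgetMass_filter_le hκ hw hl hM _).trans (mul_le_mul_of_nonneg_left ?_ hT)
    have := hunion 1 badU (by norm_num) (by norm_num) fun k hk => by
      simpa only [one_mul] using (hdev 1 (by norm_num) (by norm_num) k hk).1
    simpa only [one_mul] using this
  have pL : (∑ a, if ∃ k ∈ Icc 1 K, badL k a.2 then p a else 0) ≤ tiltFactor κ K w l * (K * E) := by
    refine (hsnd fun y => ∃ k ∈ Icc 1 K, badL k y).trans_le ?_
    refine (sum_budgetMass_filter_le hκ hw hl hM _).trans (mul_le_mul_of_nonneg_left ?_ hT)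
    have := hunion 1 badL (by norm_num) (by norm_num) fun k hk => by
      simpa only [one_mul] using (hdev 1 (by norm_num) (by norm_num) k hk).2
    simpa only [one_mul] using this
  have htotal : ∑ a, p a ≤
      (∑ a, if ∀ k, scaleNum κ k (X a) ≤ scaleNum κ k (Y a) ∧
        scaleNum κ k (Y a) ≤ scaleNum κ k (Z a) then p a else 0) +
      ((∑ a, if ∃ k ∈ Icc 1 K, badX k (X a) then p a else 0) +
      ((∑ a, if ∃ k ∈ Icc 1 K, badZ k (Z a) then p a else 0) +
      ((∑ a, if ∃ k ∈ Icc 1 K, badU k a.2 then p a else 0) +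
      (∑ a, if ∃ k ∈ Icc 1 K, badL k a.2 then p a else 0)))) := by
    simp only [← sum_add_distrib]
    refine sum_le_sum fun a _ => ?_
    have h0 := hp a
    have hn : ∀ (T : Prop) [Decidable T], 0 ≤ if T then p a else 0 := fun T _ => by
      split_ifs
      · exact h0
      · exact le_rfl
    have n0 := hn (∀ k, scaleNum κ k (X a) ≤ scaleNum κ k (Y a) ∧
        scaleNum κ k (Y a) ≤ scaleNum κ k (Z a))
    have n1 := hn (∃ k ∈ Icc 1 K, badX k (X a))
    have n2 := hn (∃ k ∈ Icc 1 K, badZ k (Z a))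
    have n3 := hn (∃ k ∈ Icc 1 K, badU k a.2)
    have n4 := hn (∃ k ∈ Icc 1 K, badL k a.2)
    by_cases h : ∀ k, scaleNum κ k (X a) ≤ scaleNum κ k (Y a) ∧
        scaleNum κ k (Y a) ≤ scaleNum κ k (Z a)
    · rw [if_pos h]
      linarith
    · rcases hnest a h with h1 | h1 | h1 | h1
      · rw [if_pos h1]
        linarith
      · rw [if_pos h1]
        linarith
      · rw [if_pos h1]
        linarith
      · rw [if_pos h1]
        linarith
  rw [hsum] at htotal
  have : (K : ℝ) * (2 + 2 * tiltFactor κ K w l) * E =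
      K * E + (K * E + (tiltFactor κ K w l * (K * E) + tiltFactor κ K w l * (K * E))) := by ring
  linarith

end Sandwich

/-! ### Graphs as configurations of potential edges -/

section GraphConfig

variable {V : Type*}

/-- The potential edges of a graph on `V`. -/
abbrev Slot (V : Type*) : Type _ := {e : Sym2 V // ¬ e.IsDiag}

open Classical in
/-- A simple graph as the configuration of its edges among the potential ones. -/
noncomputable def graphConfig : SimpleGraph V ≃ (Slot V → Bool) where
  toFun G e := decide (e.1 ∈ G.edgeSet)
  invFun x := SimpleGraph.fromEdgeSet {e | ∃ h : ¬ e.IsDiag, x ⟨e, h⟩ = true}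
  left_inv G := by
    rw [← SimpleGraph.edgeSet_inj, SimpleGraph.edgeSet_fromEdgeSet]
    ext e
    simp only [decide_eq_true_eq, exists_prop, Set.mem_sdiff, Set.mem_ofPred_eq,
      Sym2.mem_diagSet]
    exact ⟨fun h => h.1.2, fun h => ⟨⟨G.not_isDiag_of_mem_edgeSet h, h⟩,
      G.not_isDiag_of_mem_edgeSet h⟩⟩
  right_inv x := by
    ext ⟨e, he⟩
    simp [he]

theorem graphConfig_eq_true {G : SimpleGraph V} {e : Slot V} :
    graphConfig G e = true ↔ e.1 ∈ G.edgeSet := by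
  simp [graphConfig]

theorem graphConfig_symm_adj {x : Slot V → Bool} {u v : V} (h : ¬ s(u, v).IsDiag) :
    (graphConfig.symm x).Adj u v ↔ x ⟨s(u, v), h⟩ = true := by
  rw [← SimpleGraph.mem_edgeSet]
  have := graphConfig_eq_true (G := graphConfig.symm x) (e := ⟨s(u, v), h⟩)
  rw [Equiv.apply_symm_apply] at this
  exact this.symm

theorem graphConfig_le_iff {G H : SimpleGraph V} : graphConfig G ≤ graphConfig H ↔ G ≤ H := by
  rw [← SimpleGraph.edgeSet_subset_edgeSet, Pi.le_def]
  simp only [Bool.le_iff_imp, graphConfig_eq_true]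
  exact ⟨fun h e he => h ⟨e, G.not_isDiag_of_mem_edgeSet he⟩ he, fun h e he => h he⟩

variable [Fintype V] [DecidableEq V]

theorem productMass_eq_prodWeight (Q : Sym2 V → ℝ) (G : SimpleGraph V) :
    productMass Q G = prodWeight (bern fun e : Slot V => Q e.1) (graphConfig G) := by
  classical
  rw [productMass, prodWeight, prod_subtype (p := fun e : Sym2 V => ¬ e.IsDiag) _ (by simp)]
  refine prod_congr rfl fun e _ => ?_
  by_cases he : e.1 ∈ G.edgeSet
  · simp [bern, he, graphConfig_eq_true.mpr he]
  · have : graphConfig G e = false := by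
      rw [← Bool.not_eq_true, graphConfig_eq_true]
      exact he
    simp [bern, he, this]

theorem mem_boundedCostGraphs_iff [Nonempty V] {c : Sym2 V → ℝ} {B : ℝ} {G : SimpleGraph V} :
    G ∈ boundedCostGraphs c B ↔
      configCost (fun e : Slot V => c e.1) (graphConfig G) ≤ B * Fintype.card V := by
  classical
  have hn : (0 : ℝ) < Fintype.card V := by exact_mod_cast Fintype.card_pos
  have hcost : (∑ e : Sym2 V with e ∈ G.edgeSet, c e) =
      configCost (fun e : Slot V => c e.1) (graphConfig G) := by
    rw [configCost, ← sum_filter]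
    refine Eq.trans ?_ (sum_map {e : Slot V | graphConfig G e = true}
      (Function.Embedding.subtype _) c)
    refine sum_congr ?_ fun _ _ => rfl
    ext e
    simp only [mem_filter, mem_univ, true_and, Finset.mem_map, graphConfig_eq_true,
      Function.Embedding.subtype_apply, Subtype.exists, exists_and_left, exists_prop]
    constructor
    · intro he
      exact ⟨e, he, G.not_isDiag_of_mem_edgeSet he, rfl⟩
    · rintro ⟨e', he, -, rfl⟩
      exact he
  simp only [boundedCostGraphs, mem_filter, mem_univ, true_and]
  rw [hcost, one_div, inv_mul_le_iff₀ hn, mul_comm]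

theorem card_boundedCostGraphs [Nonempty V] (c : Sym2 V → ℝ) (B : ℝ) :
    #(boundedCostGraphs c B) =
      #{x : Slot V → Bool | configCost (fun e => c e.1) x ≤ B * Fintype.card V} := by
  refine card_equiv graphConfig fun G => ?_
  rw [mem_boundedCostGraphs_iff, mem_filter]
  simp

theorem uniformMass_eq_budgetMass [Nonempty V] (c : Sym2 V → ℝ) (B : ℝ) (G : SimpleGraph V) :
    uniformMass (boundedCostGraphs c B) G =
      budgetMass (fun e : Slot V => c e.1) (B * Fintype.card V) (graphConfig G) := by
  simp only [uniformMass, budgetMass, mem_boundedCostGraphs_iff, card_boundedCostGraphs]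

open Classical in
theorem le_uniformProb_of_sum_budgetMass_le [Nonempty V] {c : Sym2 V → ℝ} {B δ : ℝ} (hB : 0 ≤ B)
    {P : SimpleGraph V → Prop}
    (h : (∑ x, if ¬ P (graphConfig.symm x) then
      budgetMass (fun e : Slot V => c e.1) (B * Fintype.card V) x else 0) ≤ δ) :
    1 - δ ≤ uniformProb (boundedCostGraphs c B) P := by
  have hM : 0 ≤ B * Fintype.card V := by positivity
  have h1 : uniformProb (boundedCostGraphs c B) P = ∑ x, if P (graphConfig.symm x) then
      budgetMass (fun e : Slot V => c e.1) (B * Fintype.card V) x else 0 := by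
    rw [← Equiv.sum_comp graphConfig, uniformProb, card_filter, Nat.cast_sum, sum_div,
      ← sum_filter_add_sum_filter_not univ (· ∈ boundedCostGraphs c B), filter_univ_mem]
    have : (∑ G with G ∉ boundedCostGraphs c B,
        if P (graphConfig.symm (graphConfig G)) then
          budgetMass (fun e : Slot V => c e.1) (B * Fintype.card V) (graphConfig G) else 0) = 0 := by
      refine sum_eq_zero fun G hG => ?_
      rw [← uniformMass_eq_budgetMass, uniformMass, if_neg (mem_filter.mp hG).2, ite_self]
    rw [this, add_zero]
    refine sum_congr rfl fun G hG => ?_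
    rw [← uniformMass_eq_budgetMass, uniformMass, if_pos hG, Equiv.symm_apply_apply]
    split_ifs <;> simp
  have h2 := sum_budgetMass (c := fun e : Slot V => c e.1) hM
  have h3 : (∑ x, if P (graphConfig.symm x) then
      budgetMass (fun e : Slot V => c e.1) (B * Fintype.card V) x else 0) +
      (∑ x, if ¬ P (graphConfig.symm x) then
      budgetMass (fun e : Slot V => c e.1) (B * Fintype.card V) x else 0) = 1 := by
    rw [← h2, ← sum_add_distrib]
    refine sum_congr rfl fun x _ => ?_
    by_cases hx : P (graphConfig.symm x) <;> simp [hx]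
  rw [h1]
  linarith

theorem sum_graphConfig {_ : Fintype (SimpleGraph V)} (f : (Slot V → Bool) → ℝ) :
    ∑ G : SimpleGraph V, f (graphConfig G) = ∑ x, f x :=
  Equiv.sum_comp graphConfig f

theorem sum_sum_graphConfig {_ : Fintype (SimpleGraph V)}
    (f : (Slot V → Bool) → (Slot V → Bool) → ℝ) :
    ∑ G : SimpleGraph V, ∑ H : SimpleGraph V, f (graphConfig G) (graphConfig H) =
      ∑ x, ∑ y, f x y := by
  rw [← sum_graphConfig]
  exact sum_congr rfl fun G _ => sum_graphConfig (f (graphConfig G))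

theorem sum_sum_sum_graphConfig {_ : Fintype (SimpleGraph V)}
    (f : (Slot V → Bool) → (Slot V → Bool) → (Slot V → Bool) → ℝ) :
    ∑ G : SimpleGraph V, ∑ H : SimpleGraph V, ∑ I : SimpleGraph V,
      f (graphConfig G) (graphConfig H) (graphConfig I) = ∑ x, ∑ y, ∑ z, f x y z := by
  rw [← sum_graphConfig]
  exact sum_congr rfl fun G _ => sum_sum_graphConfig (f (graphConfig G))

open Classical in
theorem isSandwichedBy_of_config [Nonempty V] {c Q : Sym2 V → ℝ} {B ε δ δ' : ℝ}
    (hQ : ∀ e, 0 ≤ Q e ∧ Q e ≤ 1 / 2) (hε0 : 0 ≤ ε) (hε1 : ε ≤ 1) (hδ : δ' ≤ δ)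
    (h : ∃ W : (Slot V → Bool) → (Slot V → Bool) → (Slot V → Bool) → ℝ,
      (∀ x y z, 0 ≤ W x y z) ∧
      (∀ x, ∑ y, ∑ z, W x y z = prodWeight (bern fun e => (1 - ε) * Q e.1) x) ∧
      (∀ y, ∑ x, ∑ z, W x y z = budgetMass (fun e => c e.1) (B * Fintype.card V) y) ∧
      (∀ z, ∑ x, ∑ y, W x y z = prodWeight (bern fun e => (1 + ε) * Q e.1) z) ∧
      1 - δ' ≤ ∑ x, ∑ y, ∑ z, if x ≤ y ∧ y ≤ z then W x y z else 0) :
    IsSandwichedBy (boundedCostGraphs c B) Q ε δ := by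
  obtain ⟨W, h0, h1, h2, h3, h4⟩ := h
  refine ⟨fun e _ => ⟨mul_nonneg (by linarith) (hQ e).1, by nlinarith [(hQ e).1, (hQ e).2]⟩,
    fun H G H' => W (graphConfig H) (graphConfig G) (graphConfig H'), fun _ _ _ => h0 _ _ _,
    fun H => ?_, fun G => ?_, fun H' => ?_, ?_⟩
  · beta_reduce
    rw [sum_sum_graphConfig fun y z => W (graphConfig H) y z, h1, productMass_eq_prodWeight]
  · beta_reduce
    rw [sum_sum_graphConfig fun x z => W x (graphConfig G) z, h2, ← uniformMass_eq_budgetMass]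
  · beta_reduce
    rw [sum_sum_graphConfig fun x y => W x y (graphConfig H'), h3, productMass_eq_prodWeight]
  · refine (sub_le_sub_left hδ 1).trans (h4.trans (le_of_eq ?_))
    simp only [← graphConfig_le_iff]
    rw [sum_sum_sum_graphConfig fun x y z => if x ≤ y ∧ y ≤ z then W x y z else 0]

end GraphConfig

/-! ### Greedy search -/

section Greedy

variable {V : Type*}

open Classical in
/-- A member of `M`, chosen as a function of the set `M` only; the default is `v`. -/
noncomputable def pickVertex (M : Finset (V × ℝ)) (v : V) : V :=
  if h : M.Nonempty then h.choose.1 else v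

open Classical in
/-- Greedy search: move to a neighbour at minimal distance from the target. Ties are broken by a
choice that depends only on the set of minimizers, so that the move does not depend on the edges to
vertices farther from the target than some neighbour. -/
noncomputable def greedy : DecentralizedAlgorithm V := fun _ v view =>
  pickVertex {p ∈ view | ∀ p' ∈ view, p.2 ≤ p'.2} v

theorem Geometry.IsSubstrate.exists_closer {Γ : Geometry V} {E₀ : SimpleGraph V}
    (hE : Γ.IsSubstrate E₀) (E : SimpleGraph V) {v t : V} (hvt : v ≠ t) :
    ∃ u, (E₀ ⊔ E).Adj v u ∧ Γ.dist u t < Γ.dist v t := by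
  obtain ⟨u, hu, hd⟩ := hE v t hvt
  exact ⟨u, SimpleGraph.sup_adj _ _ _ _ |>.mpr (Or.inl hu), by linarith⟩

theorem sup_graphConfig_adj_congr (E₀ : SimpleGraph V) {x y : Slot V → Bool} {u v : V}
    (h : ∀ huv : ¬ s(u, v).IsDiag, x ⟨s(u, v), huv⟩ = y ⟨s(u, v), huv⟩) :
    (E₀ ⊔ graphConfig.symm x).Adj u v ↔ (E₀ ⊔ graphConfig.symm y).Adj u v := by
  rw [SimpleGraph.sup_adj, SimpleGraph.sup_adj]
  by_cases huv : s(u, v).IsDiag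
  · rw [Sym2.mk_isDiag_iff] at huv
    subst huv
    simp
  · rw [graphConfig_symm_adj huv, graphConfig_symm_adj huv, h huv]

variable [Fintype V]

/-- One move of greedy search. -/
noncomputable def greedyStep (Γ : Geometry V) (G : SimpleGraph V) (t v : V) : V :=
  greedy t v (localView Γ G t v)

theorem mem_localView {Γ : Geometry V} {G : SimpleGraph V} {t v : V} {p : V × ℝ} :
    p ∈ localView Γ G t v ↔ G.Adj v p.1 ∧ p.2 = Γ.dist p.1 t := by
  classical
  simp only [localView, mem_image, mem_filter, mem_univ, true_and]
  constructor
  · rintro ⟨u, hu, rfl⟩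
    exact ⟨hu, rfl⟩
  · rintro ⟨h1, h2⟩
    exact ⟨p.1, h1, by rw [← h2]⟩

theorem greedyStep_spec (Γ : Geometry V) {G : SimpleGraph V} (t : V) {v u : V} (h : G.Adj v u) :
    G.Adj v (greedyStep Γ G t v) ∧
      ∀ u', G.Adj v u' → Γ.dist (greedyStep Γ G t v) t ≤ Γ.dist u' t := by
  classical
  obtain ⟨p, hp, hmin⟩ := (localView Γ G t v).exists_min_image Prod.snd
    ⟨(u, Γ.dist u t), mem_localView.mpr ⟨h, rfl⟩⟩
  have hne : ({p ∈ localView Γ G t v | ∀ p' ∈ localView Γ G t v, p.2 ≤ p'.2}).Nonempty :=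
    ⟨p, mem_filter.mpr ⟨hp, hmin⟩⟩
  have hstep : greedyStep Γ G t v = hne.choose.1 := by
    rw [greedyStep, greedy, pickVertex, dif_pos hne]
  have hc := mem_filter.mp hne.choose_spec
  have hc1 := mem_localView.mp hc.1
  rw [hstep, ← hc1.2]
  exact ⟨hc1.1, fun u' hu' => hc.2 (u', Γ.dist u' t) (mem_localView.mpr ⟨hu', rfl⟩)⟩

theorem greedyStep_congr {Γ : Geometry V} {G H : SimpleGraph V} {t v u : V} (hu : G.Adj v u)
    (hut : Γ.dist u t < Γ.dist v t)
    (hGH : ∀ w, Γ.dist w t < Γ.dist v t → (G.Adj v w ↔ H.Adj v w)) :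
    greedyStep Γ G t v = greedyStep Γ H t v := by
  classical
  have key : ∀ G H : SimpleGraph V, G.Adj v u →
      (∀ w, Γ.dist w t < Γ.dist v t → (G.Adj v w ↔ H.Adj v w)) →
      ∀ p, (p ∈ localView Γ G t v ∧ ∀ p' ∈ localView Γ G t v, p.2 ≤ p'.2) →
        (p ∈ localView Γ H t v ∧ ∀ p' ∈ localView Γ H t v, p.2 ≤ p'.2) := by
    rintro G H hu hGH p ⟨hp, hmin⟩
    rw [mem_localView] at hp
    have hpu : p.2 ≤ Γ.dist u t := hmin (u, Γ.dist u t) (mem_localView.mpr ⟨hu, rfl⟩)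
    refine ⟨mem_localView.mpr ⟨(hGH _ ?_).mp hp.1, hp.2⟩, fun p' hp' => ?_⟩
    · rw [← hp.2]
      exact hpu.trans_lt hut
    · rw [mem_localView] at hp'
      rcases lt_or_ge (Γ.dist p'.1 t) (Γ.dist v t) with h | h
      · exact hmin p' (mem_localView.mpr ⟨(hGH _ h).mpr hp'.1, hp'.2⟩)
      · rw [hp'.2]
        exact (hpu.trans_lt hut).le.trans h
  have hset : ({p ∈ localView Γ G t v | ∀ p' ∈ localView Γ G t v, p.2 ≤ p'.2}) =
      {p ∈ localView Γ H t v | ∀ p' ∈ localView Γ H t v, p.2 ≤ p'.2} := by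
    ext p
    rw [mem_filter, mem_filter]
    exact ⟨key G H hu hGH p, key H G ((hGH u hut).mp hu) (fun w hw => (hGH w hw).symm) p⟩
  rw [greedyStep, greedyStep, greedy, greedy, hset]

theorem Geometry.IsSubstrate.dist_greedyStep_lt {Γ : Geometry V} {E₀ : SimpleGraph V}
    (hE : Γ.IsSubstrate E₀) (E : SimpleGraph V) {v t : V} (hvt : v ≠ t) :
    Γ.dist (greedyStep Γ (E₀ ⊔ E) t v) t < Γ.dist v t := by
  obtain ⟨u, hu, hd⟩ := hE.exists_closer E hvt
  exact ((greedyStep_spec Γ t hu).2 u hu).trans_lt hd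

/-- Greedy search from `v` takes `T` moves without reaching `t`, none of which divides the distance
to `t` by `1 / lam`. -/
def Stalls (Γ : Geometry V) (lam : ℝ) (G : SimpleGraph V) (t : V) : ℕ → V → Prop
  | 0, _ => True
  | T + 1, v => v ≠ t ∧ lam * Γ.dist v t < Γ.dist (greedyStep Γ G t v) t ∧
      Stalls Γ lam G t T (greedyStep Γ G t v)

theorem exists_progress_of_not_stalls {Γ : Geometry V} {lam : ℝ} (hlam : 0 ≤ lam)
    {E₀ : SimpleGraph V} (hE : Γ.IsSubstrate E₀) (E : SimpleGraph V) (t : V) (T : ℕ) (v : V)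
    (h : ¬ Stalls Γ lam (E₀ ⊔ E) t T v) :
    ∃ j ≤ T, (∀ i < j, (greedyStep Γ (E₀ ⊔ E) t)^[i] v ≠ t) ∧
      ((greedyStep Γ (E₀ ⊔ E) t)^[j] v = t ∨
        Γ.dist ((greedyStep Γ (E₀ ⊔ E) t)^[j] v) t ≤ lam * Γ.dist v t) := by
  induction T generalizing v with
  | zero => exact absurd trivial h
  | succ T ih =>
    by_cases hvt : v = t
    · exact ⟨0, Nat.zero_le _, fun i hi => absurd hi (Nat.not_lt_zero i), Or.inl hvt⟩
    by_cases hd : lam * Γ.dist v t < Γ.dist (greedyStep Γ (E₀ ⊔ E) t v) t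
    · obtain ⟨j, hj, hne, hend⟩ := ih _ fun hs => h ⟨hvt, hd, hs⟩
      refine ⟨j + 1, by omega, fun i hi => ?_, ?_⟩
      · cases i with
        | zero => exact hvt
        | succ i =>
          rw [Function.iterate_succ_apply]
          exact hne i (by omega)
      · rw [Function.iterate_succ_apply]
        refine hend.imp id fun hle => hle.trans ?_
        exact mul_le_mul_of_nonneg_left (hE.dist_greedyStep_lt E hvt).le hlam
    · refine ⟨1, by omega, fun i hi => ?_, Or.inr (not_lt.mp hd)⟩
      obtain rfl : i = 0 := by omega
      exact hvt

theorem exists_reach_of_not_stalls {Γ : Geometry V} {lam : ℝ} (hlam : 0 ≤ lam)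
    {E₀ : SimpleGraph V} (hE : Γ.IsSubstrate E₀) (E : SimpleGraph V) (t : V) (T : ℕ)
    (h : ∀ v, ¬ Stalls Γ lam (E₀ ⊔ E) t T v) (M : ℕ) (s : V) (hs : lam ^ M * Γ.dist s t < 1) :
    ∃ m ≤ T * M, (greedyStep Γ (E₀ ⊔ E) t)^[m] s = t ∧
      ∀ i < m, (greedyStep Γ (E₀ ⊔ E) t)^[i] s ≠ t := by
  induction M generalizing s with
  | zero =>
    refine ⟨0, Nat.zero_le _, ?_, fun i hi => absurd hi (Nat.not_lt_zero i)⟩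
    by_contra hne
    -- A substrate edge leaving `s ≠ t` shows that `s` is at distance at least one from `t`.
    obtain ⟨u, -, hu⟩ := hE s t hne
    have := Γ.dist_nonneg u t
    rw [pow_zero, one_mul] at hs
    linarith
  | succ M ih =>
    obtain ⟨j, hj, hne, hend⟩ := exists_progress_of_not_stalls hlam hE E t T s (h s)
    rcases hend with hend | hend
    · exact ⟨j, hj.trans (Nat.le_mul_of_pos_right T (Nat.succ_pos M)), hend, hne⟩
    · have hlt : lam ^ M * Γ.dist ((greedyStep Γ (E₀ ⊔ E) t)^[j] s) t < 1 := by
        refine lt_of_le_of_lt ?_ hs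
        rw [pow_succ, mul_assoc]
        exact mul_le_mul_of_nonneg_left hend (pow_nonneg hlam M)
      obtain ⟨m, hm, hmt, hmne⟩ := ih _ hlt
      refine ⟨m + j, ?_, ?_, fun i hi => ?_⟩
      · rw [Nat.mul_succ]
        omega
      · rw [Function.iterate_add_apply]
        exact hmt
      · rcases lt_or_ge i j with hij | hij
        · exact hne i hij
        · have := hmne (i - j) (by omega)
          rw [← Function.iterate_add_apply, Nat.sub_add_cancel hij] at this
          exact this

theorem navigableBy_of_not_stalls {Γ : Geometry V} {lam : ℝ} (hlam : 0 ≤ lam)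
    {E₀ : SimpleGraph V} (hE : Γ.IsSubstrate E₀) (E : SimpleGraph V) {T M : ℕ} {L : ℝ}
    (hL : (T * M : ℕ) ≤ L) (hM : ∀ s t, lam ^ M * Γ.dist s t < 1)
    (h : ∀ t v, ¬ Stalls Γ lam (E₀ ⊔ E) t T v) : NavigableBy greedy Γ (E₀ ⊔ E) L := by
  intro s t
  obtain ⟨m, hm, hmt, hne⟩ := exists_reach_of_not_stalls hlam hE E t T (h t) M s (hM s t)
  refine ⟨m, le_trans (by exact_mod_cast hm) hL, hmt, fun i hi => ?_⟩
  obtain ⟨u, hu, -⟩ := hE.exists_closer E (hne i hi)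
  have := (greedyStep_spec Γ t hu).1
  change (E₀ ⊔ E).Adj ((greedyStep Γ (E₀ ⊔ E) t)^[i] s) ((greedyStep Γ (E₀ ⊔ E) t)^[i + 1] s)
  rw [Function.iterate_succ_apply']
  exact this

variable [DecidableEq V]

open Classical in
/-- The potential edges from `v` to the vertices whose distance to `t` is at most `lam` times that
of `v`. -/
noncomputable def helpfulSlots (Γ : Geometry V) (lam : ℝ) (v t : V) : Finset (Slot V) :=
  {e | ∃ u, e.1 = s(v, u) ∧ Γ.dist u t ≤ lam * Γ.dist v t}

/-- Once greedy search has come closer to `t` than `v`, its moves do not depend on the edges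
at `v`. -/
theorem stalls_congr {Γ : Geometry V} {lam : ℝ} {E₀ : SimpleGraph V} (hE : Γ.IsSubstrate E₀)
    {v t : V} {x y : Slot V → Bool} (hxy : ∀ e : Slot V, ¬ v ∈ e.1 → x e = y e) (T : ℕ) (w : V)
    (hw : Γ.dist w t < Γ.dist v t) :
    Stalls Γ lam (E₀ ⊔ graphConfig.symm x) t T w ↔
      Stalls Γ lam (E₀ ⊔ graphConfig.symm y) t T w := by
  induction T generalizing w with
  | zero => exact Iff.rfl
  | succ T ih =>
    by_cases hwt : w = t
    · simp [Stalls, hwt]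
    obtain ⟨u, hu, hd⟩ := hE.exists_closer (graphConfig.symm x) hwt
    have hstep : greedyStep Γ (E₀ ⊔ graphConfig.symm x) t w =
        greedyStep Γ (E₀ ⊔ graphConfig.symm y) t w := by
      refine greedyStep_congr hu hd fun u' hu' => sup_graphConfig_adj_congr E₀ fun h => hxy _ ?_
      rw [Sym2.mem_iff]
      rintro (rfl | rfl)
      · exact lt_irrefl _ hw
      · exact lt_asymm hw hu'
    have := ih _ ((hE.dist_greedyStep_lt (graphConfig.symm x) hwt).trans hw)
    simp only [Stalls, ← hstep, this]

/-- Under a product measure the edges used by the successive moves of greedy search can be revealed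
one vertex at a time, so each move independently has a chance to be helpful. -/
theorem prodProb_stalls_le {Γ : Geometry V} {lam : ℝ} {E₀ : SimpleGraph V}
    (hE : Γ.IsSubstrate E₀) {q : Slot V → ℝ} (h0 : ∀ e, 0 ≤ q e) (h1 : ∀ e, q e ≤ 1) {t : V}
    {σ : ℝ} (hσ : ∀ v, v ≠ t → σ ≤ ∑ e ∈ helpfulSlots Γ lam v t, q e) (T : ℕ) (v : V) :
    prodProb (bern q) (fun x => Stalls Γ lam (E₀ ⊔ graphConfig.symm x) t T v) ≤
      Real.exp (-σ) ^ T := by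
  classical
  have hbn := bern_nonneg h0 h1
  induction T generalizing v with
  | zero => exact prodProb_le_one hbn (sum_bern q) _
  | succ T ih =>
    by_cases hvt : v = t
    · refine le_trans (le_of_eq ?_) (pow_nonneg (Real.exp_nonneg _) _)
      rw [prodProb, sum_filter]
      exact sum_eq_zero fun x _ => if_neg fun h => h.1 hvt
    set A : V → (Slot V → Bool) → Prop := fun w x =>
      (∀ e ∈ helpfulSlots Γ lam v t, x e = false) ∧
        greedyStep Γ (E₀ ⊔ graphConfig.symm x) t v = w with hA
    set s : Finset V := {w | Γ.dist w t < Γ.dist v t} with hs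
    have hsub : prodProb (bern q) (fun x => Stalls Γ lam (E₀ ⊔ graphConfig.symm x) t (T + 1) v) ≤
        ∑ w ∈ s, prodProb (bern q)
          (fun x => A w x ∧ Stalls Γ lam (E₀ ⊔ graphConfig.symm x) t T w) := by
      refine (prodProb_mono hbn fun x hx => ?_).trans (prodProb_exists_le hbn s _)
      refine ⟨_, mem_filter.mpr ⟨mem_univ _, hE.dist_greedyStep_lt (graphConfig.symm x) hvt⟩,
        ⟨fun e he => ?_, rfl⟩, hx.2.2⟩
      obtain ⟨u, heu, hu⟩ := (mem_filter.mp he).2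
      by_contra hxe
      rw [Bool.not_eq_false] at hxe
      have hne : ¬ s(v, u).IsDiag := heu ▸ e.2
      have hadj : (E₀ ⊔ graphConfig.symm x).Adj v u := by
        rw [SimpleGraph.sup_adj, graphConfig_symm_adj hne]
        right
        rw [← hxe]
        congr 1
        exact Subtype.ext heu.symm
      have := (greedyStep_spec Γ t hadj).2 u hadj
      linarith [hx.2.1]
    have hind : ∀ w ∈ s, prodProb (bern q)
        (fun x => A w x ∧ Stalls Γ lam (E₀ ⊔ graphConfig.symm x) t T w) ≤
        prodProb (bern q) (A w) * Real.exp (-σ) ^ T := by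
      intro w hw
      rw [prodProb_and_eq_mul (sum_bern q) (fun e : Slot V => v ∈ e.1)]
      · exact mul_le_mul_of_nonneg_left (ih w) (prodProb_nonneg hbn _)
      · intro x y hxy
        have e1 : (∀ e ∈ helpfulSlots Γ lam v t, x e = false) ↔
            ∀ e ∈ helpfulSlots Γ lam v t, y e = false := by
          refine forall₂_congr fun e he => ?_
          obtain ⟨u, heu, -⟩ := (mem_filter.mp he).2
          rw [hxy e (by rw [heu]; exact Sym2.mem_mk_left v u)]
        have e2 : greedyStep Γ (E₀ ⊔ graphConfig.symm x) t v =
            greedyStep Γ (E₀ ⊔ graphConfig.symm y) t v := by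
          obtain ⟨u, hu, hd⟩ := hE.exists_closer (graphConfig.symm x) hvt
          exact greedyStep_congr hu hd fun u' _ => sup_graphConfig_adj_congr E₀ fun h =>
            hxy _ (Sym2.mem_mk_left v u')
        simp only [hA, e1, e2]
      · intro x y hxy
        exact stalls_congr hE hxy T w (mem_filter.mp hw).2
    have hdisj : ∑ w ∈ s, prodProb (bern q) (A w) ≤
        prodProb (bern q) (fun x => ∀ e ∈ helpfulSlots Γ lam v t, x e = false) := by
      simp only [prodProb, sum_filter]
      rw [sum_comm]
      refine sum_le_sum fun x _ => ?_
      have hw := prodWeight_nonneg hbn x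
      by_cases hx : ∀ e ∈ helpfulSlots Γ lam v t, x e = false
      · rw [if_pos hx]
        refine (sum_le_sum (g := fun w => if greedyStep Γ (E₀ ⊔ graphConfig.symm x) t v = w then
          prodWeight (bern q) x else 0) fun w _ => ?_).trans ?_
        · by_cases hAw : A w x
          · rw [if_pos hAw, if_pos hAw.2]
          · rw [if_neg hAw]
            split_ifs
            · exact hw
            · exact le_rfl
        rw [sum_ite_eq]
        split_ifs
        · exact le_rfl
        · exact hw
      · rw [if_neg hx]
        exact (sum_eq_zero fun w _ => if_neg fun h => hx h.1).le
    have hfresh : prodProb (bern q) (fun x => ∀ e ∈ helpfulSlots Γ lam v t, x e = false) ≤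
        Real.exp (-σ) :=
      (prodProb_forall_false_le h1 _).trans (Real.exp_le_exp.mpr (neg_le_neg (hσ v hvt)))
    calc _ ≤ ∑ w ∈ s, prodProb (bern q) (A w) * Real.exp (-σ) ^ T :=
          hsub.trans (sum_le_sum hind)
      _ = (∑ w ∈ s, prodProb (bern q) (A w)) * Real.exp (-σ) ^ T := by rw [sum_mul]
      _ ≤ Real.exp (-σ) * Real.exp (-σ) ^ T :=
          mul_le_mul_of_nonneg_right (hdisj.trans hfresh) (pow_nonneg (Real.exp_nonneg _) _)
      _ = _ := by rw [pow_succ, mul_comm]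

theorem prodProb_not_navigableBy_le {Γ : Geometry V} {lam : ℝ} (hlam : 0 ≤ lam)
    {E₀ : SimpleGraph V} (hE : Γ.IsSubstrate E₀) {q : Slot V → ℝ} (h0 : ∀ e, 0 ≤ q e)
    (h1 : ∀ e, q e ≤ 1) {σ : ℝ}
    (hσ : ∀ v t, v ≠ t → σ ≤ ∑ e ∈ helpfulSlots Γ lam v t, q e) {T M : ℕ} {L : ℝ}
    (hL : (T * M : ℕ) ≤ L) (hM : ∀ s t, lam ^ M * Γ.dist s t < 1) :
    prodProb (bern q) (fun x => ¬ NavigableBy greedy Γ (E₀ ⊔ graphConfig.symm x) L) ≤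
      (Fintype.card V : ℝ) ^ 2 * Real.exp (-σ) ^ T := by
  have hbn := bern_nonneg h0 h1
  calc _ ≤ prodProb (bern q) (fun x => ∃ a ∈ (univ : Finset (V × V)),
        Stalls Γ lam (E₀ ⊔ graphConfig.symm x) a.1 T a.2) := by
        refine prodProb_mono hbn fun x hx => ?_
        by_contra hno
        push Not at hno
        exact hx (navigableBy_of_not_stalls hlam hE _ hL hM fun t v => hno (t, v) (mem_univ _))
    _ ≤ ∑ a : V × V, Real.exp (-σ) ^ T :=
        (prodProb_exists_le hbn _ _).trans (sum_le_sum fun a _ =>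
          prodProb_stalls_le hE h0 h1 (fun v hv => hσ v a.1 hv) T a.2)
    _ = _ := by
        rw [sum_const, card_univ, Fintype.card_prod, nsmul_eq_mul]
        push_cast
        ring

end Greedy

/-! ### Coherent geometries -/

theorem inScale_pos {γ x : ℝ} {k : ℕ} (hγ : 1 < γ) (h : InScale γ k x) : 0 < x :=
  (zpow_pos (by linarith) _).trans h.1

theorem le_of_inScale_of_le_pow {γ x : ℝ} {j k : ℕ} (hγ : 1 < γ) (h : InScale γ j x)
    (hx : x ≤ γ ^ k) : j ≤ k := by
  have h1 : γ ^ ((j : ℤ) - 1) < γ ^ (k : ℤ) := by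
    rw [zpow_natCast]
    exact h.1.trans_le hx
  have := (zpow_lt_zpow_iff_right₀ hγ).mp h1
  omega

namespace Geometry

variable {V : Type*} [Fintype V]

/-- The scale of a potential edge. -/
noncomputable def slotScale (Γ : Geometry V) (γ : ℝ) (e : Slot V) : ℕ :=
  scaleIndex γ (Γ.edgeDist e.1)

theorem scaleDensity_nonneg (Γ : Geometry V) (γ : ℝ) (k : ℕ) : 0 ≤ Γ.scaleDensity γ k := by
  unfold scaleDensity
  positivity

namespace IsCoherent

variable {Γ : Geometry V} {γ a A φ lam : ℝ}

theorem inScale_slotScale (h : Γ.IsCoherent γ a A φ lam) (hγ : 1 < γ) (e : Slot V) :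
    InScale γ (Γ.slotScale γ e) (Γ.edgeDist e.1) ∧
      Γ.slotScale γ e ≤ numScales γ (Fintype.card V) := by
  obtain ⟨⟨u, v⟩, he⟩ := e
  obtain ⟨k, hk, hs⟩ := h.exists_scale u v fun huv => he (Sym2.mk_isDiag_iff.mpr huv)
  have : Γ.slotScale γ ⟨s(u, v), he⟩ = k := scaleIndex_eq hγ hs
  change InScale γ (Γ.slotScale γ ⟨s(u, v), he⟩) _ ∧ Γ.slotScale γ ⟨s(u, v), he⟩ ≤ _
  rw [this]
  exact ⟨hs, hk⟩

theorem slotScale_eq_iff (h : Γ.IsCoherent γ a A φ lam) (hγ : 1 < γ) {e : Slot V} {k : ℕ} :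
    Γ.slotScale γ e = k ↔ InScale γ k (Γ.edgeDist e.1) :=
  ⟨fun hk => hk ▸ (h.inScale_slotScale hγ e).1, fun hs => scaleIndex_eq hγ hs⟩

theorem dist_le (h : Γ.IsCoherent γ a A φ lam) (hγ : 1 < γ) (s t : V) :
    Γ.dist s t ≤ γ ^ numScales γ (Fintype.card V) := by
  by_cases hst : s = t
  · rw [(Γ.dist_eq_zero s t).mpr hst]
    positivity
  · obtain ⟨k, hk, hs⟩ := h.exists_scale s t hst
    exact hs.2.trans (pow_le_pow_right₀ hγ.le hk)

theorem ballCount_le (h : Γ.IsCoherent γ a A φ lam) (hγ : 1 < γ) (hA : 0 < A) {u v : V} {k : ℕ}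
    (hk : k ≤ numScales γ (Fintype.card V)) (hs : InScale γ k (Γ.dist u v)) :
    (Γ.ballCount u (Γ.dist u v) : ℝ) ≤ (1 + A * γ / (γ - 1)) * (1 + γ ^ k) := by
  classical
  have hsub : ({w : V | Γ.dist u w ≤ Γ.dist u v} : Finset V) ⊆
      {u} ∪ (range (k + 1)).biUnion fun j => {w : V | InScale γ j (Γ.dist u w)} := by
    intro w hw
    have hw := (mem_filter.mp hw).2
    by_cases huw : u = w
    · exact mem_union_left _ (mem_singleton.mpr huw.symm)
    · obtain ⟨j, -, hj⟩ := h.exists_scale u w huw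
      refine mem_union_right _ (mem_biUnion.mpr ⟨j, mem_range.mpr (Nat.lt_succ_of_le ?_),
        mem_filter.mpr ⟨mem_univ _, hj⟩⟩)
      exact le_of_inScale_of_le_pow hγ hj (hw.trans hs.2)
  have hcard : (Γ.ballCount u (Γ.dist u v) : ℝ) ≤
      1 + ∑ j ∈ range (k + 1), (Γ.scaleCount γ j u : ℝ) := by
    have h1 : Γ.ballCount u (Γ.dist u v) ≤ 1 + ∑ j ∈ range (k + 1), Γ.scaleCount γ j u := by
      refine le_trans (le_trans (le_of_eq ?_) (card_le_card hsub)) ((card_union_le _ _).trans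
        (add_le_add (le_of_eq (card_singleton u)) (card_biUnion_le.trans (le_of_eq ?_))))
      · unfold ballCount
        congr!
      · unfold scaleCount
        congr!
    exact_mod_cast h1
  have hterm : ∀ j ∈ range (k + 1), (Γ.scaleCount γ j u : ℝ) ≤ A * γ ^ j := by
    intro j hj
    have hj := mem_range.mp hj
    rcases Nat.eq_zero_or_pos j with rfl | hj0
    · simpa using h.growth_zero u
    · exact (h.growth u j (mem_Icc.mpr ⟨hj0, by omega⟩)).2
  have hgeom : ∑ j ∈ range (k + 1), A * γ ^ j ≤ A * γ / (γ - 1) * γ ^ k := by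
    rw [← mul_sum, geom_sum_eq hγ.ne', mul_div_assoc', div_mul_eq_mul_div]
    have : 0 < γ - 1 := by linarith
    refine div_le_div_of_nonneg_right ?_ this.le
    rw [pow_succ]
    nlinarith
  have h2 := hcard.trans (add_le_add_right ((sum_le_sum hterm).trans hgeom) 1)
  have h3 : 0 ≤ A * γ / (γ - 1) := div_nonneg (by nlinarith) (by linarith)
  have h4 : 0 < γ ^ k := pow_pos (by linarith) k
  nlinarith

theorem le_ballCount (h : Γ.IsCoherent γ a A φ lam) (hγ : 1 < γ) (ha : 0 < a) {u v : V} {k : ℕ}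
    (hk : k ≤ numScales γ (Fintype.card V)) (hs : InScale γ k (Γ.dist u v)) :
    min (a / (2 * γ)) (1 / (1 + γ)) * (1 + γ ^ k) ≤ Γ.ballCount u (Γ.dist u v) := by
  classical
  have hγ0 : 0 < γ := by linarith
  rcases Nat.lt_or_ge k 2 with hk2 | hk2
  · have h1 : 1 ≤ Γ.ballCount u (Γ.dist u v) := by
      refine card_pos.mpr ⟨u, mem_filter.mpr ⟨mem_univ _, ?_⟩⟩
      rw [(Γ.dist_eq_zero u u).mpr rfl]
      exact Γ.dist_nonneg u v
    have h2 : γ ^ k ≤ γ := by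
      have := pow_le_pow_right₀ hγ.le (show k ≤ 1 by omega)
      rwa [pow_one] at this
    calc min (a / (2 * γ)) (1 / (1 + γ)) * (1 + γ ^ k) ≤ 1 / (1 + γ) * (1 + γ) := by
          gcongr
          exact min_le_right _ _
      _ = 1 := by field_simp
      _ ≤ _ := by exact_mod_cast h1
  · obtain ⟨j, rfl⟩ : ∃ j, k = j + 1 := ⟨k - 1, by omega⟩
    have h1 : Γ.scaleCount γ j u ≤ Γ.ballCount u (Γ.dist u v) := by
      refine card_le_card fun w hw => ?_
      rw [mem_filter] at hw ⊢
      refine ⟨mem_univ _, hw.2.2.trans (le_trans ?_ hs.1.le)⟩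
      rw [← zpow_natCast]
      exact le_of_eq (by congr 1; push_cast; ring)
    have h2 := (h.growth u j (mem_Icc.mpr ⟨by omega, by omega⟩)).1
    have h3 : (1 : ℝ) ≤ γ ^ (j + 1) := one_le_pow₀ hγ.le
    calc min (a / (2 * γ)) (1 / (1 + γ)) * (1 + γ ^ (j + 1))
        ≤ a / (2 * γ) * (2 * γ ^ (j + 1)) := by
          gcongr
          · exact min_le_left _ _
          · linarith
      _ = a * γ ^ j := by
          rw [pow_succ]
          field_simp
      _ ≤ Γ.scaleCount γ j u := h2
      _ ≤ _ := by exact_mod_cast h1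

variable [DecidableEq V]

/-- Each potential edge of a scale is counted at both of its endpoints. -/
theorem sum_scaleCount (h : Γ.IsCoherent γ a A φ lam) (hγ : 1 < γ) (k : ℕ) :
    ∑ v, Γ.scaleCount γ k v = 2 * scaleSize (Γ.slotScale γ) k := by
  classical
  let H : SimpleGraph V :=
    { Adj := fun u v => InScale γ k (Γ.dist u v)
      symm := ⟨fun u v huv => by rwa [Γ.dist_symm]⟩
      loopless := ⟨fun u hu => (inScale_pos hγ hu).ne' ((Γ.dist_eq_zero u u).mpr rfl)⟩ }
  have h1 : ∀ v, Γ.scaleCount γ k v = H.degree v := by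
    intro v
    rw [← SimpleGraph.card_neighborFinset_eq_degree, SimpleGraph.neighborFinset_eq_filter,
      scaleCount]
  have h2 : scaleSize (Γ.slotScale γ) k = #H.edgeFinset := by
    rw [scaleSize, ← card_map (Function.Embedding.subtype _)]
    congr 1
    ext e
    induction e with
    | _ u v =>
      simp only [Finset.mem_map, mem_filter, mem_univ, true_and, Function.Embedding.subtype_apply,
        Subtype.exists, exists_and_right, exists_eq_right, SimpleGraph.mem_edgeFinset,
        SimpleGraph.mem_edgeSet]
      constructor
      · rintro ⟨he, hk⟩
        exact (h.slotScale_eq_iff hγ).mp hk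
      · intro huv
        have he : ¬ s(u, v).IsDiag := fun hd => H.ne_of_adj huv (Sym2.mk_isDiag_iff.mp hd)
        exact ⟨he, (h.slotScale_eq_iff hγ (e := ⟨s(u, v), he⟩)).mpr huv⟩
  rw [h2, ← SimpleGraph.sum_degrees_eq_twice_card_edges]
  exact sum_congr rfl fun v _ => h1 v

theorem scaleDensity_eq (h : Γ.IsCoherent γ a A φ lam) (hγ : 1 < γ) (k : ℕ) :
    Γ.scaleDensity γ k = scaleSize (Γ.slotScale γ) k / Fintype.card V := by
  classical
  rw [scaleDensity, scaleSize, ← card_map (Function.Embedding.subtype fun e : Sym2 V => ¬ e.IsDiag)]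
  congr 3
  ext e
  simp only [Finset.mem_map, mem_filter, mem_univ, true_and, Function.Embedding.subtype_apply,
    Subtype.exists, exists_and_right, exists_eq_right]
  constructor
  · intro hs
    have he : ¬ e.IsDiag := by
      induction e with
      | _ u v =>
        intro hd
        have := inScale_pos hγ hs
        rw [Sym2.mk_isDiag_iff] at hd
        exact this.ne' ((Γ.dist_eq_zero u v).mpr hd)
    exact ⟨he, (h.slotScale_eq_iff hγ (e := ⟨e, he⟩)).mpr hs⟩
  · rintro ⟨he, hk⟩
    exact (h.slotScale_eq_iff hγ).mp hk

theorem le_scaleSize (h : Γ.IsCoherent γ a A φ lam) (hγ : 1 < γ) {k : ℕ}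
    (hk : k ∈ Icc 1 (numScales γ (Fintype.card V))) :
    a * γ ^ k * Fintype.card V / 2 ≤ scaleSize (Γ.slotScale γ) k := by
  have h1 := sum_le_sum fun v (_ : v ∈ univ) => (h.growth v k hk).1
  rw [← Nat.cast_sum, h.sum_scaleCount hγ k, sum_const, card_univ, nsmul_eq_mul] at h1
  push_cast at h1
  linarith

theorem scaleSize_le (h : Γ.IsCoherent γ a A φ lam) (hγ : 1 < γ) {k : ℕ}
    (hk : k ≤ numScales γ (Fintype.card V)) :
    (scaleSize (Γ.slotScale γ) k : ℝ) ≤ A * γ ^ k * Fintype.card V / 2 := by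
  have h0 : ∀ v, (Γ.scaleCount γ k v : ℝ) ≤ A * γ ^ k := by
    intro v
    rcases Nat.eq_zero_or_pos k with rfl | hk0
    · simpa using h.growth_zero v
    · exact (h.growth v k (mem_Icc.mpr ⟨hk0, hk⟩)).2
  have h1 := sum_le_sum fun v (_ : v ∈ univ) => h0 v
  rw [← Nat.cast_sum, h.sum_scaleCount hγ k, sum_const, card_univ, nsmul_eq_mul] at h1
  push_cast at h1
  linarith

theorem two_mul_scaleSize_le_sq (h : Γ.IsCoherent γ a A φ lam) (hγ : 1 < γ) (k : ℕ) :
    2 * (scaleSize (Γ.slotScale γ) k : ℝ) ≤ (Fintype.card V : ℝ) ^ 2 := by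
  have h1 : ∑ v, Γ.scaleCount γ k v ≤ ∑ _v : V, Fintype.card V :=
    sum_le_sum fun v _ => card_le_univ _
  rw [h.sum_scaleCount hγ k, sum_const, card_univ, smul_eq_mul, ← sq] at h1
  exact_mod_cast h1

/-- If every potential edge of scale `k` is present with probability at least `1 / (1 + γ ^ k)`,
then every vertex has in expectation a constant number of helpful neighbours. -/
theorem le_sum_helpfulSlots (h : Γ.IsCoherent γ a A φ lam) (hγ : 1 < γ) (hlam : lam < 1)
    {q : Slot V → ℝ} (hq : ∀ e, 1 / (1 + γ ^ Γ.slotScale γ e) ≤ q e) {v t : V} (hvt : v ≠ t) :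
    φ / 2 ≤ ∑ e ∈ helpfulSlots Γ lam v t, q e := by
  classical
  have hγ0 : 0 < γ := by linarith
  obtain ⟨k, -, hs⟩ := h.exists_scale v t hvt
  have hpos := inScale_pos hγ hs
  have hcard := h.isotropy v t hvt k hs
  have hne : ∀ u ∈ Γ.helpful γ lam k v t, ¬ s(v, u).IsDiag := by
    intro u hu hd
    rw [Sym2.mk_isDiag_iff] at hd
    subst hd
    have := (mem_filter.mp hu).2.2
    nlinarith
  have hq0 : ∀ e, 0 ≤ q e := fun e => le_trans (by positivity) (hq e)
  let f : {u // u ∈ Γ.helpful γ lam k v t} → Slot V := fun u => ⟨s(v, u.1), hne u.1 u.2⟩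
  have hinj : Function.Injective f := by
    intro u u' huu
    have : s(v, u.1) = s(v, u'.1) := congrArg Subtype.val huu
    exact Subtype.ext (Sym2.congr_right.mp this)
  have hsub : univ.map ⟨f, hinj⟩ ⊆ helpfulSlots Γ lam v t := by
    intro e he
    obtain ⟨u, -, rfl⟩ := Finset.mem_map.mp he
    exact mem_filter.mpr ⟨mem_univ _, u.1, rfl, (mem_filter.mp u.2).2.2⟩
  have hterm : ∀ u, 1 / (2 * γ ^ k) ≤ q (f u) := by
    intro u
    refine le_trans ?_ (hq (f u))
    have h1 : Γ.slotScale γ (f u) ≤ k :=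
      le_of_inScale_of_le_pow hγ (h.inScale_slotScale hγ (f u)).1 (mem_filter.mp u.2).2.1
    have h2 := pow_le_pow_right₀ hγ.le h1
    have h3 : (1 : ℝ) ≤ γ ^ k := one_le_pow₀ hγ.le
    gcongr
    linarith
  calc φ / 2 = φ * γ ^ k * (1 / (2 * γ ^ k)) := by field_simp
    _ ≤ #(Γ.helpful γ lam k v t) * (1 / (2 * γ ^ k)) := by gcongr
    _ = ∑ u : {u // u ∈ Γ.helpful γ lam k v t}, 1 / (2 * γ ^ k) := by
        rw [sum_const, card_univ, Fintype.card_coe, nsmul_eq_mul]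
    _ ≤ ∑ u, q (f u) := sum_le_sum fun u _ => hterm u
    _ = ∑ e ∈ univ.map ⟨f, hinj⟩, q e := by rw [sum_map]; rfl
    _ ≤ _ := sum_le_sum_of_subset_of_nonneg hsub fun e _ _ => hq0 e

end IsCoherent

/-! ### The entropy maximizing profile -/

/-- The average cost per vertex under the Gibbs measure of parameter `l`. -/
noncomputable def meanCost (Γ : Geometry V) (γ α l : ℝ) : ℝ :=
  ∑ k ∈ range (numScales γ (Fintype.card V) + 1),
    Γ.scaleDensity γ k / (1 + Real.exp (l * ((k : ℝ) / α))) * ((k : ℝ) / α)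

theorem negMulLog_le_tangent {x y : ℝ} (hx : 0 < x) (hy : 0 ≤ y) :
    Real.negMulLog y ≤ -y * Real.log x + x - y := by
  rcases hy.eq_or_lt with rfl | hy
  · simp [hx.le]
  · have h1 := Real.log_le_sub_one_of_pos (div_pos hx hy)
    rw [Real.log_div hx.ne' hy.ne'] at h1
    have h2 := mul_le_mul_of_nonneg_left h1 hy.le
    have h3 : y * (x / y - 1) = x - y := by field_simp
    rw [h3] at h2
    rw [Real.negMulLog]
    linarith

/-- The Gibbs profile maximizes the entropy among the profiles of the same cost: the entropy is
concave, and its slope in direction `k` at the Gibbs profile is proportional to the cost of the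
scale `k`. -/
theorem isOptimalProfile_gibbs (Γ : Geometry V) (γ : ℝ) {α l : ℝ} (hl : 0 ≤ l) :
    Γ.IsOptimalProfile γ α (Γ.meanCost γ α l)
      (fun k => Γ.scaleDensity γ k / (1 + Real.exp (l * ((k : ℝ) / α)))) := by
  have hp := Γ.scaleDensity_nonneg γ
  refine ⟨⟨fun k _ => ⟨by have := hp k; positivity, div_le_self (hp k) ?_⟩, le_rfl⟩,
    fun y hy => ?_⟩
  · linarith [Real.exp_pos (l * ((k : ℝ) / α))]
  set x : ℕ → ℝ := fun k => Γ.scaleDensity γ k / (1 + Real.exp (l * ((k : ℝ) / α))) with hx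
  have key : ∀ k ∈ range (numScales γ (Fintype.card V) + 1),
      Real.negMulLog (Γ.scaleDensity γ k - y k) + Real.negMulLog (y k) ≤
        Real.negMulLog (Γ.scaleDensity γ k - x k) + Real.negMulLog (x k) +
          l * (y k * ((k : ℝ) / α) - x k * ((k : ℝ) / α)) := by
    intro k hk
    obtain ⟨hy0, hyp⟩ := hy.1 k hk
    rcases (hp k).eq_or_lt with h0 | h0
    · have hy' : y k = 0 := le_antisymm (by rw [h0]; exact hyp) hy0
      have hx' : x k = 0 := by simp [hx, ← h0]
      simp [hy', hx', ← h0]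
    · set E := Real.exp (l * ((k : ℝ) / α)) with hE
      have hEpos : 0 < E := Real.exp_pos _
      have hxpos : 0 < x k := by positivity
      have hpx : Γ.scaleDensity γ k - x k = x k * E := by
        have : x k = Γ.scaleDensity γ k / (1 + E) := rfl
        rw [this]
        field_simp
        ring
      have hlog : Real.log (Γ.scaleDensity γ k - x k) = Real.log (x k) + l * ((k : ℝ) / α) := by
        rw [hpx, Real.log_mul hxpos.ne' hEpos.ne', hE, Real.log_exp]
      have hpxpos : 0 < Γ.scaleDensity γ k - x k := by
        rw [hpx]
        positivity
      have t1 := negMulLog_le_tangent hpxpos (sub_nonneg.mpr hyp)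
      have t2 := negMulLog_le_tangent hxpos hy0
      rw [hlog] at t1
      have e1 : Real.negMulLog (Γ.scaleDensity γ k - x k) =
          -(Γ.scaleDensity γ k - x k) * (Real.log (x k) + l * ((k : ℝ) / α)) := by
        rw [Real.negMulLog, hlog]
      have e2 : Real.negMulLog (x k) = -(x k) * Real.log (x k) := rfl
      rw [e1, e2]
      linarith
  have hsum : Γ.profileEntropy γ y ≤ Γ.profileEntropy γ x +
      l * (∑ k ∈ range (numScales γ (Fintype.card V) + 1), y k * ((k : ℝ) / α) -
        ∑ k ∈ range (numScales γ (Fintype.card V) + 1), x k * ((k : ℝ) / α)) := by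
    rw [profileEntropy, profileEntropy, ← sum_sub_distrib, mul_sum, ← sum_add_distrib]
    exact sum_le_sum key
  have hcost := mul_nonneg hl (sub_nonneg.mpr hy.2)
  have : Γ.meanCost γ α l =
    ∑ k ∈ range (numScales γ (Fintype.card V) + 1), x k * ((k : ℝ) / α) := rfl
  rw [this, mul_sub] at hcost
  rw [mul_sub] at hsum
  linarith

end Geometry

/-! ### Budgets and quantitative estimates -/

theorem eventually_log_ge (D : ℝ) : ∀ᶠ n : ℕ in atTop, D ≤ Real.log n :=
  (Real.tendsto_log_atTop.comp tendsto_natCast_atTop_atTop).eventually_ge_atTop D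

theorem eventually_mul_log_pow_le (D : ℝ) (m : ℕ) : ∀ᶠ n : ℕ in atTop, D * Real.log n ^ m ≤ n := by
  have h := (Real.isLittleO_pow_log_id_atTop (n := m)).bound
    (c := 1 / (|D| + 1)) (by positivity)
  have h2 := tendsto_natCast_atTop_atTop (R := ℝ).eventually h
  filter_upwards [h2, eventually_log_ge 0] with n hn h0
  simp only [id, Real.norm_eq_abs, abs_pow, abs_of_nonneg h0, Nat.abs_cast] at hn
  rw [div_mul_eq_mul_div, one_mul, le_div_iff₀ (by positivity)] at hn
  have : 0 ≤ Real.log n ^ m := pow_nonneg h0 m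
  nlinarith [le_abs_self D]

theorem numScales_add_one_le {γ : ℝ} (hγ : 1 < γ) {n : ℕ} (hn : 1 ≤ Real.log n) :
    (numScales γ n : ℝ) + 1 ≤ (1 / Real.log γ + 2) * Real.log n := by
  have hlog : 0 < Real.log γ := Real.log_pos hγ
  have h0 : 0 ≤ Real.logb γ n := div_nonneg (by linarith) hlog.le
  have h1 := (Nat.ceil_lt_add_one h0).le
  have h2 : Real.logb γ n = 1 / Real.log γ * Real.log n := by
    rw [Real.logb]
    ring
  rw [h2] at h1
  rw [numScales, h2]
  nlinarith

theorem le_pow_numScales {γ : ℝ} (hγ : 1 < γ) {n : ℕ} (hn : 0 < n) :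
    (n : ℝ) ≤ γ ^ numScales γ n := by
  have hn' : (0 : ℝ) < n := by exact_mod_cast hn
  have h1 := Nat.le_ceil (Real.logb γ n)
  rw [Real.logb_le_iff_le_rpow hγ hn', Real.rpow_natCast] at h1
  exact h1

theorem exp_mul_scale_le {γ α l : ℝ} (hγ : 1 < γ) (hα : 0 < α) (hl : l ≤ α * Real.log γ) (k : ℕ) :
    Real.exp (l * ((k : ℝ) / α)) ≤ γ ^ k := by
  have h1 : l * ((k : ℝ) / α) ≤ α * Real.log γ * ((k : ℝ) / α) :=
    mul_le_mul_of_nonneg_right hl (by positivity)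
  have h2 : α * Real.log γ * ((k : ℝ) / α) = k * Real.log γ := by
    field_simp
  rw [h2] at h1
  refine (Real.exp_le_exp.mpr h1).trans (le_of_eq ?_)
  rw [Real.exp_nat_mul, Real.exp_log (by linarith)]

theorem exp_mul_scale_eq {γ α : ℝ} (hγ : 1 < γ) (hα : 0 < α) (k : ℕ) :
    Real.exp (α * Real.log γ * ((k : ℝ) / α)) = γ ^ k := by
  have h2 : α * Real.log γ * ((k : ℝ) / α) = k * Real.log γ := by
    field_simp
  rw [h2, Real.exp_nat_mul, Real.exp_log (by linarith)]

namespace Geometry.IsCoherent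

variable {n : ℕ} {Γ : Geometry (Fin n)} {γ a A φ lam : ℝ}

theorem sum_slot_cost (h : Γ.IsCoherent γ a A φ lam) (hγ : 1 < γ) (hn : 0 < n) (α l : ℝ) :
    ∑ e : Slot (Fin n), 1 / (1 + Real.exp (l * ((Γ.slotScale γ e : ℝ) / α))) *
      ((Γ.slotScale γ e : ℝ) / α) = Γ.meanCost γ α l * n := by
  have hn' : (n : ℝ) ≠ 0 := by exact_mod_cast hn.ne'
  rw [sum_eq_sum_scaleSize (fun e => (h.inScale_slotScale hγ e).2) fun k =>
    1 / (1 + Real.exp (l * ((k : ℝ) / α))) * ((k : ℝ) / α), meanCost, sum_mul]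
  refine sum_congr rfl fun k _ => ?_
  rw [h.scaleDensity_eq hγ, Fintype.card_fin]
  field_simp

theorem meanCost_nonneg (Γ : Geometry (Fin n)) (γ : ℝ) {α : ℝ} (hα : 0 < α) (l : ℝ) :
    0 ≤ Γ.meanCost γ α l := by
  refine sum_nonneg fun k _ => ?_
  have := Γ.scaleDensity_nonneg γ k
  positivity

theorem le_meanCost_zero (h : Γ.IsCoherent γ a A φ lam) (hγ : 1 < γ) (ha : 0 < a) {α : ℝ}
    (hα : 0 < α) (hn : 1 ≤ Real.log n) : a / (4 * α) * n ≤ Γ.meanCost γ α 0 := by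
  have hn0 : 0 < n := by
    rcases Nat.eq_zero_or_pos n with rfl | h0
    · norm_num at hn
    · exact h0
  have hn' : (0 : ℝ) < n := by exact_mod_cast hn0
  set K := numScales γ (Fintype.card (Fin n)) with hK
  have hKn : (n : ℝ) ≤ γ ^ K := by
    rw [hK, Fintype.card_fin]
    exact le_pow_numScales hγ hn0
  have hK1 : 1 ≤ K := by
    rw [hK, Fintype.card_fin]
    exact Nat.ceil_pos.mpr (div_pos (by linarith) (Real.log_pos hγ))
  have h1 : a * γ ^ K / 2 ≤ Γ.scaleDensity γ K := by
    rw [h.scaleDensity_eq hγ, Fintype.card_fin, le_div_iff₀ hn']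
    have := h.le_scaleSize hγ (k := K) (mem_Icc.mpr ⟨hK1, le_rfl⟩)
    rw [Fintype.card_fin] at this
    linarith
  have hK1' : (1 : ℝ) ≤ K := by exact_mod_cast hK1
  have hp := Γ.scaleDensity_nonneg γ K
  calc a / (4 * α) * n ≤ a / (4 * α) * γ ^ K := by gcongr
    _ = a * γ ^ K / 2 / 2 * (1 / α) := by ring
    _ ≤ Γ.scaleDensity γ K / 2 * ((K : ℝ) / α) := by gcongr
    _ = Γ.scaleDensity γ K / (1 + Real.exp (0 * ((K : ℝ) / α))) * ((K : ℝ) / α) := by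
        rw [zero_mul, Real.exp_zero]
        norm_num
    _ ≤ _ := by
        refine single_le_sum (f := fun k : ℕ => Γ.scaleDensity γ k /
          (1 + Real.exp (0 * ((k : ℝ) / α))) * ((k : ℝ) / α)) (fun k _ => ?_)
          (mem_range.mpr (Nat.lt_succ_self K))
        have := Γ.scaleDensity_nonneg γ k
        positivity

theorem meanCost_pos (h : Γ.IsCoherent γ a A φ lam) (hγ : 1 < γ) (ha : 0 < a) {α : ℝ}
    (hα : 0 < α) (hn : 1 ≤ Real.log n) (l : ℝ) : 0 < Γ.meanCost γ α l := by
  -- The signs of the terms do not depend on the parameter, so it may be taken to be zero.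
  by_contra hle
  have h0 : Γ.meanCost γ α l = 0 := le_antisymm (not_lt.mp hle) (meanCost_nonneg Γ γ hα l)
  have hp := Γ.scaleDensity_nonneg γ
  rw [meanCost, sum_eq_zero_iff_of_nonneg fun k _ => by have := hp k; positivity] at h0
  have h1 : Γ.meanCost γ α 0 = 0 := by
    refine sum_eq_zero fun k hk => ?_
    have := h0 k hk
    have he : 1 + Real.exp (l * ((k : ℝ) / α)) ≠ 0 := by positivity
    rcases mul_eq_zero.mp this with h2 | h2
    · rw [(div_eq_zero_iff.mp h2).resolve_right he, zero_div, zero_mul]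
    · rw [h2, mul_zero]
  have h2 := h.le_meanCost_zero hγ ha hα hn
  have hn0 : (0 : ℝ) < n := by
    rcases Nat.eq_zero_or_pos n with rfl | h0
    · norm_num at hn
    · exact_mod_cast h0
  have : 0 < a / (4 * α) * n := by positivity
  linarith

theorem meanCost_rank_le (h : Γ.IsCoherent γ a A φ lam) (hγ : 1 < γ) (hA : 0 < A) {α : ℝ}
    (hα : 0 < α) (hn : 1 ≤ Real.log n) :
    Γ.meanCost γ α (α * Real.log γ) ≤
      A * (1 / Real.log γ + 2) ^ 2 / (2 * α) * Real.log n ^ 2 := by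
  have hγ0 : 0 < γ := by linarith
  have hn0 : (0 : ℝ) < n := by
    rcases Nat.eq_zero_or_pos n with rfl | h0
    · norm_num at hn
    · exact_mod_cast h0
  have hK := numScales_add_one_le hγ hn
  set K := numScales γ n with hKdef
  have hterm : ∀ k ∈ range (K + 1), Γ.scaleDensity γ k /
      (1 + Real.exp (α * Real.log γ * ((k : ℝ) / α))) * ((k : ℝ) / α) ≤
        A / 2 * (((K : ℝ) + 1) / α) := by
    intro k hk
    have hk' := mem_range.mp hk
    have hkK : (k : ℝ) ≤ K + 1 := by exact_mod_cast hk'.le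
    rw [exp_mul_scale_eq hγ hα]
    have h1 : Γ.scaleDensity γ k ≤ A * γ ^ k / 2 := by
      rw [h.scaleDensity_eq hγ, Fintype.card_fin, div_le_iff₀ hn0]
      have := h.scaleSize_le hγ (k := k) (by rw [Fintype.card_fin]; omega)
      rw [Fintype.card_fin] at this
      linarith
    have h2 : Γ.scaleDensity γ k / (1 + γ ^ k) ≤ A / 2 := by
      have hp : 0 < γ ^ k := by positivity
      rw [div_le_iff₀ (by positivity)]
      nlinarith
    gcongr
  rw [meanCost, Fintype.card_fin]
  refine (sum_le_sum hterm).trans ?_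
  rw [sum_const, card_range, nsmul_eq_mul]
  push_cast
  have hK0 : (0 : ℝ) ≤ (K : ℝ) + 1 := by positivity
  calc ((K : ℝ) + 1) * (A / 2 * (((K : ℝ) + 1) / α)) = A / (2 * α) * ((K : ℝ) + 1) ^ 2 := by
        field_simp
    _ ≤ A / (2 * α) * ((1 / Real.log γ + 2) * Real.log n) ^ 2 := by gcongr
    _ = _ := by ring

/-- Every budget between the cost of rank-based augmentation and the cost of a uniformly random
graph is the mean cost of a Gibbs measure whose parameter is at most that of rank-based
augmentation. -/
theorem exists_meanCost_eq (Γ : Geometry (Fin n)) (hγ : 1 < γ) {α B : ℝ} (hα : 0 < α)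
    (h1 : Γ.meanCost γ α (α * Real.log γ) ≤ B) (h2 : B ≤ Γ.meanCost γ α 0) :
    ∃ l, 0 ≤ l ∧ l ≤ α * Real.log γ ∧ Γ.meanCost γ α l = B := by
  have hcont : Continuous (Γ.meanCost γ α) := by
    unfold meanCost
    refine continuous_finsetSum _ fun k _ => Continuous.mul (Continuous.div continuous_const
      (by fun_prop) fun l => ?_) continuous_const
    positivity
  have h0 : 0 ≤ α * Real.log γ := mul_nonneg hα.le (Real.log_pos hγ).le
  obtain ⟨l, hl, hlB⟩ := intermediate_value_Icc' h0 hcont.continuousOn ⟨h1, h2⟩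
  exact ⟨l, hl.1, hl.2, hlB⟩

theorem tiltFactor_le (h : Γ.IsCoherent γ a A φ lam) (hγ : 1 < γ) {α l : ℝ} (hα : 0 < α)
    (hl : l ≤ α * Real.log γ) (hn : 1 ≤ Real.log n) :
    tiltFactor (Γ.slotScale γ) (numScales γ n) (fun k => (k : ℝ) / α) l ≤
      Real.exp ((3 * (1 / Real.log γ + 2) + Real.log γ * (1 / Real.log γ + 2) ^ 2) *
        Real.log n ^ 2) := by
  have hlog : 0 < Real.log γ := Real.log_pos hγ
  have hn1 : (0 : ℝ) < n := by
    rcases Nat.eq_zero_or_pos n with rfl | h0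
    · norm_num at hn
    · exact_mod_cast h0
  have hn2 : (2 : ℝ) ≤ n := by
    have := Real.add_one_le_exp (Real.log n)
    rw [Real.exp_log hn1] at this
    linarith
  have hK := numScales_add_one_le hγ hn
  set K := numScales γ n with hKdef
  set c := 1 / Real.log γ + 2 with hc
  have hprod : ∏ k ∈ range (K + 1), (2 * ((scaleSize (Γ.slotScale γ) k : ℝ) + 1)) ≤
      Real.exp (3 * Real.log n) ^ (K + 1) := by
    refine (prod_le_prod (g := fun _ => Real.exp (3 * Real.log n)) (fun k _ => by positivity)
      fun k _ => ?_).trans (by rw [prod_const, card_range])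
    have h1 := h.two_mul_scaleSize_le_sq hγ k
    rw [Fintype.card_fin] at h1
    have h2 : Real.exp (3 * Real.log n) = (n : ℝ) ^ 3 := by
      rw [show (3 : ℝ) * Real.log n = ((3 : ℕ) : ℝ) * Real.log n by norm_num, Real.exp_nat_mul,
        Real.exp_log hn1]
    rw [h2]
    nlinarith [mul_le_mul_of_nonneg_right hn2 (sq_nonneg (n : ℝ))]
  have hsum : l * ∑ k ∈ range (K + 1), (k : ℝ) / α ≤ Real.log γ * ((K : ℝ) + 1) ^ 2 := by
    have h1 : ∑ k ∈ range (K + 1), (k : ℝ) / α ≤ ((K : ℝ) + 1) * (((K : ℝ) + 1) / α) := by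
      refine (sum_le_sum (g := fun _ => ((K : ℝ) + 1) / α) fun k hk => ?_).trans (le_of_eq ?_)
      · have : (k : ℝ) ≤ K + 1 := by exact_mod_cast (mem_range.mp hk).le
        gcongr
      · rw [sum_const, card_range, nsmul_eq_mul]
        push_cast
        ring
    have h0 : 0 ≤ ∑ k ∈ range (K + 1), (k : ℝ) / α := sum_nonneg fun k _ => by positivity
    calc _ ≤ α * Real.log γ * (((K : ℝ) + 1) * (((K : ℝ) + 1) / α)) :=
          mul_le_mul hl h1 h0 (by positivity)
      _ = _ := by field_simp
  rw [tiltFactor]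
  calc _ ≤ Real.exp (3 * Real.log n) ^ (K + 1) * Real.exp (Real.log γ * ((K : ℝ) + 1) ^ 2) :=
        mul_le_mul hprod (Real.exp_le_exp.mpr hsum) (Real.exp_nonneg _) (by positivity)
    _ = Real.exp (((K : ℝ) + 1) * (3 * Real.log n) + Real.log γ * ((K : ℝ) + 1) ^ 2) := by
        rw [← Real.exp_nat_mul, ← Real.exp_add]
        push_cast
        rfl
    _ ≤ _ := by
        refine Real.exp_le_exp.mpr ?_
        have h3 : ((K : ℝ) + 1) ^ 2 ≤ (c * Real.log n) ^ 2 := by gcongr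
        nlinarith [mul_le_mul_of_nonneg_left h3 hlog.le]

end Geometry.IsCoherent

/-! ### Sparsity, sandwich and navigability of the random graph -/

theorem edgeCount_eq_card_graphConfig {V : Type*} [Fintype V] [DecidableEq V]
    (G : SimpleGraph V) : edgeCount G = #{e : Slot V | graphConfig G e = true} := by
  classical
  rw [edgeCount, ← card_map (Function.Embedding.subtype fun e : Sym2 V => ¬ e.IsDiag)]
  congr 1
  ext e
  simp only [mem_filter, mem_univ, true_and, Finset.mem_map, graphConfig_eq_true,
    Function.Embedding.subtype_apply, Subtype.exists, exists_and_left, exists_prop]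
  constructor
  · intro he
    exact ⟨e, he, G.not_isDiag_of_mem_edgeSet he, rfl⟩
  · rintro ⟨e', he, -, rfl⟩
    exact he

/-- A number `T` of moves of order `(log n) ^ 2` makes the probability that greedy search stalls
smaller than the price `Φ` of the change of measure, with a factor `1 / n` to spare. -/
theorem change_of_measure_mul_le {n T : ℕ} {φ C Φ P : ℝ} (hn0 : 0 < n) (hn : 1 ≤ Real.log n)
    (hφ : 0 < φ) (hT : 2 * (C + 3) / φ * Real.log n ^ 2 ≤ T)
    (hΦ : Φ ≤ Real.exp (C * Real.log n ^ 2)) (hP : P ≤ (n : ℝ) ^ 2 * Real.exp (-(φ / 2)) ^ T)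
    (hP0 : 0 ≤ P) : Φ * P ≤ 1 / n := by
  have hn' : (0 : ℝ) < n := by exact_mod_cast hn0
  set x := Real.log n with hx
  have hxx : x ≤ x ^ 2 := le_self_pow₀ hn two_ne_zero
  have hexpT : Real.exp (-(φ / 2)) ^ T ≤ Real.exp (-((C + 3) * x ^ 2)) := by
    rw [← Real.exp_nat_mul]
    refine Real.exp_le_exp.mpr ?_
    have h1 := mul_le_mul_of_nonneg_right hT (show 0 ≤ φ / 2 by linarith)
    have h2 : 2 * (C + 3) / φ * x ^ 2 * (φ / 2) = (C + 3) * x ^ 2 := by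
      field_simp
    linarith
  have hnx : (n : ℝ) ^ 2 = Real.exp (2 * x) := by
    rw [show (2 : ℝ) * x = ((2 : ℕ) : ℝ) * x by norm_num, Real.exp_nat_mul, Real.exp_log hn']
  calc Φ * P ≤ Real.exp (C * x ^ 2) * ((n : ℝ) ^ 2 * Real.exp (-(φ / 2)) ^ T) :=
        mul_le_mul hΦ hP hP0 (Real.exp_nonneg _)
    _ ≤ Real.exp (C * x ^ 2) * (Real.exp (2 * x) * Real.exp (-((C + 3) * x ^ 2))) := by
        rw [hnx]
        gcongr
    _ = Real.exp (2 * x - 3 * x ^ 2) := by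
        rw [← Real.exp_add, ← Real.exp_add]
        congr 1
        ring
    _ ≤ Real.exp (-x) := Real.exp_le_exp.mpr (by linarith)
    _ = 1 / n := by
        rw [Real.exp_neg, Real.exp_log hn', one_div]

namespace Geometry.IsCoherent

variable {n : ℕ} {Γ : Geometry (Fin n)} {γ a A φ lam : ℝ}

/-- Every edge outside scale `0` costs at least `1 / α`, and scale `0` has few potential edges. -/
theorem edgeCount_le (h : Γ.IsCoherent γ a A φ lam) (hγ : 1 < γ) (hA : 0 ≤ A) {α B : ℝ}
    (hα : 0 < α) [NeZero n] {G : SimpleGraph (Fin n)}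
    (hG : G ∈ boundedCostGraphs (Γ.indexingCost γ α) B) :
    (edgeCount G : ℝ) ≤ (α * B + A) * n := by
  rw [mem_boundedCostGraphs_iff, Fintype.card_fin] at hG
  have h0 := h.scaleSize_le hγ (Nat.zero_le _)
  rw [Fintype.card_fin, pow_zero, mul_one] at h0
  have hcount : (edgeCount G : ℝ) ≤
      α * configCost (fun e : Slot (Fin n) => Γ.indexingCost γ α e.1) (graphConfig G) +
        scaleSize (Γ.slotScale γ) 0 := by
    rw [edgeCount_eq_card_graphConfig, scaleSize, configCost, card_filter, card_filter,
      Nat.cast_sum, Nat.cast_sum, mul_sum, ← sum_add_distrib]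
    refine sum_le_sum fun e _ => ?_
    have he : α * Γ.indexingCost γ α e.1 = Γ.slotScale γ e := by
      rw [indexingCost, mul_div_cancel₀ _ hα.ne']
      rfl
    by_cases hx : graphConfig G e = true
    · rw [if_pos hx, if_pos hx, he]
      rcases Nat.eq_zero_or_pos (Γ.slotScale γ e) with hz | hpos
      · simp [hz]
      · have : (1 : ℝ) ≤ Γ.slotScale γ e := by exact_mod_cast hpos
        rw [if_neg hpos.ne']
        push_cast
        linarith
    · rw [if_neg hx, if_neg hx]
      push_cast
      split_ifs <;> simp
  have h1 := mul_le_mul_of_nonneg_left hG hα.le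
  have h2 : 0 ≤ A * n := by positivity
  linarith

theorem isSandwichedBy_rank (h : Γ.IsCoherent γ a A φ lam) (hγ : 1 < γ) (ha : 0 < a) {α : ℝ}
    (hα : 0 < α) (hn : 24 ≤ Real.log n)
    (hlarge : (9 * (1 / Real.log γ + 2) + Real.log γ * (1 / Real.log γ + 2) ^ 2 + 1) *
      Real.log n ^ 3 ≤ 3 * a / 16 * n) :
    IsSandwichedBy (boundedCostGraphs (Γ.indexingCost γ α) (Γ.meanCost γ α (α * Real.log γ)))
      (gibbsMatrix (Γ.indexingCost γ α) (α * Real.log γ)) (Real.sqrt (24 / Real.log n))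
      (2 / (n : ℝ) ^ (5 * numScales γ n)) := by
  have hlog : 0 < Real.log γ := Real.log_pos hγ
  have hn0 : 0 < n := by
    rcases Nat.eq_zero_or_pos n with rfl | h0
    · norm_num at hn
    · exact h0
  have hn' : (0 : ℝ) < n := by exact_mod_cast hn0
  have : NeZero n := ⟨hn0.ne'⟩
  have hl0 : 0 ≤ α * Real.log γ := by positivity
  set K := numScales γ n with hK
  set ε := Real.sqrt (24 / Real.log n) with hε
  set x := Real.log n with hx
  have hx0 : 0 < x := by linarith
  have hεsq : ε ^ 2 = 24 / x := Real.sq_sqrt (by positivity)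
  have hε1 : ε ≤ 1 := by
    exact Real.sqrt_le_iff.mpr ⟨zero_le_one, by rwa [one_pow, div_le_one hx0]⟩
  have hb : ∀ k, 1 ≤ k → k ≤ K → a * n / 4 ≤ scaleSize (Γ.slotScale γ) k *
      (1 / (1 + Real.exp (α * Real.log γ * ((k : ℝ) / α)))) := by
    intro k hk1 hkK
    rw [exp_mul_scale_eq hγ hα]
    have h1 := h.le_scaleSize hγ (k := k) (mem_Icc.mpr ⟨hk1, by rwa [Fintype.card_fin]⟩)
    rw [Fintype.card_fin] at h1
    have h2 : (1 : ℝ) ≤ γ ^ k := one_le_pow₀ hγ.le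
    rw [mul_one_div, le_div_iff₀ (by positivity)]
    have h3 : a * n / 4 * (1 + γ ^ k) ≤ a * n / 4 * (2 * γ ^ k) := by
      gcongr
      linarith
    linarith
  have hS := exists_config_sandwich (κ := Γ.slotScale γ) (K := K)
    (fun e => by simpa only [Fintype.card_fin] using (h.inScale_slotScale hγ e).2)
    (w := fun k => (k : ℝ) / α) (fun k => by positivity) (by simp) hl0
    (h.sum_slot_cost hγ hn0 α _) (Real.sqrt_nonneg _) hε1 hb
  refine isSandwichedBy_of_config (δ' := K * (2 + 2 * tiltFactor (Γ.slotScale γ) K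
    (fun k => (k : ℝ) / α) (α * Real.log γ)) * Real.exp (-(ε ^ 2 * (a * n / 4) / 32)))
    (fun e => ⟨by unfold gibbsMatrix; positivity, ?_⟩) (Real.sqrt_nonneg _) hε1 ?_
    (by rw [Fintype.card_fin]; exact hS)
  · have h1 : 0 ≤ Γ.indexingCost γ α e := by
      unfold indexingCost
      positivity
    have := Real.one_le_exp (mul_nonneg hl0 h1)
    rw [gibbsMatrix, div_le_div_iff₀ (by positivity) (by norm_num)]
    linarith
  · -- All factors but the Chernoff bound are exponentials of multiples of `(log n) ^ 2`.
    have hKc := numScales_add_one_le hγ (n := n) (by linarith : (1 : ℝ) ≤ Real.log n)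
    have hT := h.tiltFactor_le hγ hα le_rfl (by linarith : (1 : ℝ) ≤ Real.log n)
    set Φ := tiltFactor (Γ.slotScale γ) K (fun k => (k : ℝ) / α) (α * Real.log γ) with hΦ
    set c := 1 / Real.log γ + 2 with hc
    set C₁ := 3 * c + Real.log γ * c ^ 2 with hC₁
    have hc0 : 0 < c := by positivity
    have hKx : (K : ℝ) ≤ c * x := by linarith
    have hxx : x ≤ x ^ 2 := by nlinarith
    have hX0 : 0 ≤ x ^ 2 := by positivity
    have hKe : (K : ℝ) ≤ Real.exp (c * x ^ 2) := by
      have := Real.add_one_le_exp (c * x ^ 2)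
      nlinarith
    have hC1pos : 0 ≤ C₁ := by positivity
    have hΦe : 2 + 2 * Φ ≤ 4 * Real.exp (C₁ * x ^ 2) := by
      have : 1 ≤ Real.exp (C₁ * x ^ 2) := Real.one_le_exp (by positivity)
      linarith
    have h4 : (4 : ℝ) ≤ 2 * Real.exp (x ^ 2) := by
      have := Real.add_one_le_exp (x ^ 2)
      nlinarith
    have hpow : (n : ℝ) ^ (5 * K) ≤ Real.exp (5 * c * x ^ 2) := by
      have : (n : ℝ) ^ (5 * K) = Real.exp (((5 * K : ℕ) : ℝ) * x) := by
        rw [Real.exp_nat_mul, Real.exp_log hn']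
      rw [this]
      refine Real.exp_le_exp.mpr ?_
      push_cast
      nlinarith
    have hΦ0 : 0 ≤ Φ := mul_nonneg (prod_nonneg fun k _ => by positivity) (Real.exp_nonneg _)
    have hchern : Real.exp (-(ε ^ 2 * (a * n / 4) / 32)) ≤
        Real.exp (-((6 * c + C₁ + 1) * x ^ 2)) := by
      refine Real.exp_le_exp.mpr (neg_le_neg ?_)
      rw [hεsq]
      have e1 : 24 / x * (a * n / 4) / 32 = (3 * a / 16 * n) / x := by
        field_simp
        norm_num
      rw [e1, le_div_iff₀ hx0]
      refine le_trans (le_of_eq ?_) hlarge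
      rw [hC₁]
      ring
    rw [le_div_iff₀ (by positivity)]
    calc _ ≤ Real.exp (c * x ^ 2) * (4 * Real.exp (C₁ * x ^ 2)) *
          Real.exp (-((6 * c + C₁ + 1) * x ^ 2)) * Real.exp (5 * c * x ^ 2) := by gcongr
      _ ≤ Real.exp (c * x ^ 2) * (2 * Real.exp (x ^ 2) * Real.exp (C₁ * x ^ 2)) *
          Real.exp (-((6 * c + C₁ + 1) * x ^ 2)) * Real.exp (5 * c * x ^ 2) := by gcongr
      _ = 2 * Real.exp (c * x ^ 2 + (x ^ 2 + C₁ * x ^ 2) + -((6 * c + C₁ + 1) * x ^ 2) +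
          5 * c * x ^ 2) := by
          simp only [Real.exp_add]
          ring
      _ = 2 := by
          rw [show c * x ^ 2 + (x ^ 2 + C₁ * x ^ 2) + -((6 * c + C₁ + 1) * x ^ 2) +
            5 * c * x ^ 2 = 0 by ring, Real.exp_zero, mul_one]

/-- Greedy search succeeds with high probability as soon as the budget is that of a Gibbs measure
with parameter at most that of rank-based augmentation. The number of moves allowed for each
reduction of the distance by a factor `lam` is of order `(log n) ^ 2`, so that the failure probability under the product
measure beats the price of the change of measure. -/
theorem le_uniformProb_navigableBy (h : Γ.IsCoherent γ a A φ lam) (hγ : 1 < γ) (hφ : 0 < φ)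
    (hlam0 : 0 < lam) (hlam1 : lam < 1) {α l B : ℝ} (hα : 0 < α) (hl0 : 0 ≤ l)
    (hl : l ≤ α * Real.log γ) (hB : Γ.meanCost γ α l = B) (hn : 1 ≤ Real.log n) {L ε : ℝ}
    (hε : 1 ≤ ε * n)
    (hL : (2 * (3 * (1 / Real.log γ + 2) + Real.log γ * (1 / Real.log γ + 2) ^ 2 + 3) / φ + 1) *
      (Real.log γ / (-Real.log lam) * (1 / Real.log γ + 2) + 2) * Real.log n ^ 3 ≤ L)
    {E₀ : SimpleGraph (Fin n)} (hE : Γ.IsSubstrate E₀) :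
    1 - ε ≤ uniformProb (boundedCostGraphs (Γ.indexingCost γ α) B)
      (fun E => NavigableBy greedy Γ (E₀ ⊔ E) L) := by
  classical
  have hlog : 0 < Real.log γ := Real.log_pos hγ
  have hloglam : 0 < -Real.log lam := neg_pos.mpr (Real.log_neg hlam0 hlam1)
  have hn0 : 0 < n := by
    rcases Nat.eq_zero_or_pos n with rfl | h0
    · norm_num at hn
    · exact h0
  have hn' : (0 : ℝ) < n := by exact_mod_cast hn0
  have : NeZero n := ⟨hn0.ne'⟩
  have hKc := numScales_add_one_le hγ hn
  have hT := h.tiltFactor_le hγ hα hl hn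
  set K := numScales γ n with hK
  set x := Real.log n with hx
  set c := 1 / Real.log γ + 2 with hc
  set C₁ := 3 * c + Real.log γ * c ^ 2 with hC₁
  set D := Real.log γ / (-Real.log lam) with hD
  have hc0 : 0 < c := by positivity
  have hC1pos : 0 ≤ C₁ := by positivity
  have hD0 : 0 < D := by positivity
  set C₂ := 2 * (C₁ + 3) / φ with hC₂
  have hC20 : 0 < C₂ := by positivity
  set T := ⌈C₂ * x ^ 2⌉₊ with hTdef
  set M := ⌊D * K⌋₊ + 1 with hMdef
  have hx1 : 1 ≤ x ^ 2 := one_le_pow₀ hn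
  have hTle : (T : ℝ) ≤ (C₂ + 1) * x ^ 2 := by
    have := (Nat.ceil_lt_add_one (show 0 ≤ C₂ * x ^ 2 by positivity)).le
    linarith
  have hMle : (M : ℝ) ≤ (D * c + 2) * x := by
    have h1 := Nat.floor_le (show 0 ≤ D * K by positivity)
    have h2 : D * K ≤ D * (c * x) := by
      gcongr
      linarith
    rw [hMdef]
    push_cast
    linarith
  have hTM : ((T * M : ℕ) : ℝ) ≤ L := by
    refine le_trans ?_ hL
    push_cast
    calc (T : ℝ) * M ≤ (C₂ + 1) * x ^ 2 * ((D * c + 2) * x) := by gcongr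
      _ = _ := by ring
  have hreach : ∀ s t, lam ^ M * Γ.dist s t < 1 := by
    intro s t
    have h1 := h.dist_le hγ s t
    rw [Fintype.card_fin] at h1
    have h2 : D * K < M := by
      rw [hMdef]
      push_cast
      exact Nat.lt_floor_add_one _
    rw [hD, div_mul_eq_mul_div, div_lt_iff₀ hloglam] at h2
    calc lam ^ M * Γ.dist s t ≤ lam ^ M * γ ^ K := by gcongr
      _ = Real.exp (M * Real.log lam + K * Real.log γ) := by
          rw [Real.exp_add, Real.exp_nat_mul, Real.exp_nat_mul, Real.exp_log hlam0,
            Real.exp_log (by linarith)]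
      _ < 1 := by
          rw [Real.exp_lt_one_iff]
          linarith
  set q : Slot (Fin n) → ℝ := fun e =>
    1 / (1 + Real.exp (l * ((Γ.slotScale γ e : ℝ) / α))) with hq
  have hq0 : ∀ e, 0 ≤ q e := fun e => by positivity
  have hq1 : ∀ e, q e ≤ 1 := fun e => by
    simp only [hq]
    rw [div_le_one (by positivity)]
    linarith [Real.exp_pos (l * ((Γ.slotScale γ e : ℝ) / α))]
  have hqk : ∀ e, 1 / (1 + γ ^ Γ.slotScale γ e) ≤ q e := fun e => by
    simp only [hq]
    gcongr
    exact exp_mul_scale_le hγ hα hl _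
  have hnav := prodProb_not_navigableBy_le hlam0.le hE hq0 hq1
    (fun v t hvt => h.le_sum_helpfulSlots hγ hlam1 hqk hvt) hTM hreach
  rw [Fintype.card_fin] at hnav
  have hB0 : 0 ≤ B := hB ▸ meanCost_nonneg Γ γ hα l
  refine le_uniformProb_of_sum_budgetMass_le hB0 ?_
  have hsum := sum_budgetMass_filter_le (κ := Γ.slotScale γ) (K := K)
    (fun e => by simpa only [Fintype.card_fin] using (h.inScale_slotScale hγ e).2)
    (w := fun k => (k : ℝ) / α) (fun k => by positivity) hl0 (h.sum_slot_cost hγ hn0 α l)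
    fun y => ¬ NavigableBy greedy Γ (E₀ ⊔ graphConfig.symm y) L
  rw [hB] at hsum
  rw [Fintype.card_fin]
  refine le_trans (le_trans (le_of_eq ?_) hsum) ?_
  · refine sum_congr rfl fun y _ => ?_
    split_ifs <;> rfl
  · refine le_trans ?_ ((div_le_iff₀ hn').mpr hε)
    exact change_of_measure_mul_le hn0 hn hφ (Nat.le_ceil _) hT hnav
      (prodProb_nonneg (bern_nonneg hq0 hq1) _)

end Geometry.IsCoherent

theorem theorem5 :
    -- one decentralized search algorithm, independent of geometry, substrate and random graph
    ∃ alg : ∀ n : ℕ, DecentralizedAlgorithm (Fin n),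
    ∀ γ a A φ lam α : ℝ, 1 < γ → 0 < a → 1 < A → 0 < φ → 0 < lam → lam < 1 → 0 < α →
    ∃ c₁ c₂ : ℝ, 0 < c₁ ∧ 0 < c₂ ∧
    ∀ p : ℕ, ∃ (C : ℝ) (q : ℕ), ∃ Bm Bp : ∀ n : ℕ, Geometry (Fin n) → ℝ,
      -- the ratio of the budgets outgrows the `p`-th power of `log n`
      (∀ M : ℝ, ∀ᶠ n : ℕ in atTop, ∀ Γ : Geometry (Fin n), Γ.IsCoherent γ a A φ lam →
        0 < Bm n Γ ∧ Bm n Γ ≤ Bp n Γ ∧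
        M * Real.log n ^ p ≤ Bp n Γ / Bm n Γ) ∧
      -- sparsity and navigability with high probability, for all budgets in the window
      (∀ ε > 0, ∀ᶠ n : ℕ in atTop, ∀ Γ : Geometry (Fin n), Γ.IsCoherent γ a A φ lam →
        ∀ B ∈ Set.Icc (Bm n Γ) (Bp n Γ),
          1 - ε ≤ uniformProb (boundedCostGraphs (Γ.indexingCost γ α) B)
            (fun E => (edgeCount E : ℝ) ≤ C * (n * Real.log n ^ q)) ∧
          ∀ E₀ : SimpleGraph (Fin n), Γ.IsSubstrate E₀ →
            1 - ε ≤ uniformProb (boundedCostGraphs (Γ.indexingCost γ α) B)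
              (fun E => NavigableBy (alg n) Γ (E₀ ⊔ E) (C * Real.log n ^ q))) ∧
      -- approximate recovery of rank based augmentation at a budget in the window
      (∀ᶠ n : ℕ in atTop, ∀ Γ : Geometry (Fin n), Γ.IsCoherent γ a A φ lam →
        ∃ Ba ∈ Set.Icc (Bm n Γ) (Bp n Γ), ∃ l : ℝ, 0 ≤ l ∧
          Γ.IsOptimalProfile γ α Ba
            (fun k => Γ.scaleDensity γ k / (1 + Real.exp (l * ((k : ℝ) / α)))) ∧
          IsSandwichedBy (boundedCostGraphs (Γ.indexingCost γ α) Ba)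
            (gibbsMatrix (Γ.indexingCost γ α) l)
            (Real.sqrt (24 / Real.log n))
            (2 / (n : ℝ) ^ (5 * numScales γ n)) ∧
          ∀ u v : Fin n, u ≠ v →
            c₁ / Γ.ballCount u (Γ.dist u v)
              ≤ gibbsMatrix (Γ.indexingCost γ α) l s(u, v) ∧
            gibbsMatrix (Γ.indexingCost γ α) l s(u, v)
              ≤ c₂ / Γ.ballCount u (Γ.dist u v)) := by
  refine ⟨fun n => greedy, ?_⟩
  intro γ a A φ lam α hγ ha hA hφ hlam0 hlam1 hα
  have hA0 : 0 < A := by linarith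
  have hlog : 0 < Real.log γ := Real.log_pos hγ
  have hloglam : 0 < -Real.log lam := neg_pos.mpr (Real.log_neg hlam0 hlam1)
  refine ⟨min (a / (2 * γ)) (1 / (1 + γ)), 1 + A * γ / (γ - 1), ?_, ?_, fun p => ?_⟩
  · have : 0 < γ := by linarith
    positivity
  · have h1 : 0 < γ - 1 := by linarith
    have h2 : 0 < γ := by linarith
    positivity
  set Cb := A * (1 / Real.log γ + 2) ^ 2 / (2 * α) with hCb
  set Cn := (2 * (3 * (1 / Real.log γ + 2) + Real.log γ * (1 / Real.log γ + 2) ^ 2 + 3) / φ + 1) *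
      (Real.log γ / (-Real.log lam) * (1 / Real.log γ + 2) + 2) with hCn
  have hCb0 : 0 < Cb := by positivity
  have hCn0 : 0 < Cn := by positivity
  refine ⟨α * Cb + A + Cn, p + 3, fun n Γ => Γ.meanCost γ α (α * Real.log γ),
    fun n Γ => Γ.meanCost γ α (α * Real.log γ) * Real.log n ^ (p + 1), ?_, ?_, ?_⟩
  · intro M
    filter_upwards [eventually_log_ge 1, eventually_log_ge M] with n hn hM Γ hΓ
    have hpos := hΓ.meanCost_pos hγ ha hα hn (α * Real.log γ)
    have h1 : 1 ≤ Real.log n ^ (p + 1) := one_le_pow₀ hn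
    refine ⟨hpos, le_mul_of_one_le_right hpos.le h1, ?_⟩
    rw [mul_div_cancel_left₀ _ hpos.ne', pow_succ, mul_comm]
    exact mul_le_mul_of_nonneg_left hM (by positivity)
  · intro ε hε
    -- For large `n` the upper budget is below the mean cost of a uniformly random graph.
    filter_upwards [eventually_log_ge 1, eventually_mul_log_pow_le (Cb / (a / (4 * α))) (p + 3),
      (tendsto_natCast_atTop_atTop (R := ℝ)).eventually_ge_atTop (1 / ε)]
      with n hn hlarge hnε Γ hΓ B hB
    have hn0 : 0 < n := by
      rcases Nat.eq_zero_or_pos n with rfl | h0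
      · norm_num at hn
      · exact h0
    have : NeZero n := ⟨hn0.ne'⟩
    have hBm := hΓ.meanCost_rank_le hγ hA0 hα hn
    have hB0 : 0 ≤ B := (hΓ.meanCost_pos hγ ha hα hn _).le.trans hB.1
    have hBp : B ≤ Cb * Real.log n ^ (p + 3) := by
      refine hB.2.trans ?_
      calc _ ≤ Cb * Real.log n ^ 2 * Real.log n ^ (p + 1) := by gcongr
        _ = _ := by ring
    have hx3 : 1 ≤ Real.log n ^ (p + 3) := one_le_pow₀ hn
    constructor
    · refine (sub_le_self 1 hε.le).trans ?_
      rw [← sub_zero (1 : ℝ)]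
      refine le_uniformProb_of_sum_budgetMass_le hB0 (le_of_eq (sum_eq_zero fun y _ => ?_))
      split_ifs with hy
      · rfl
      · rw [budgetMass, if_neg]
        intro hcost
        refine hy ?_
        have hmem : graphConfig.symm y ∈ boundedCostGraphs (Γ.indexingCost γ α) B := by
          rw [mem_boundedCostGraphs_iff, Equiv.apply_symm_apply]
          exact hcost
        refine (hΓ.edgeCount_le hγ hA0.le hα hmem).trans ?_
        calc (α * B + A) * n ≤ (α * (Cb * Real.log n ^ (p + 3)) + A * Real.log n ^ (p + 3)) * n := by
              gcongr
              exact le_mul_of_one_le_right hA0.le hx3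
          _ = (α * Cb + A) * (n * Real.log n ^ (p + 3)) := by ring
          _ ≤ _ := mul_le_mul_of_nonneg_right (by linarith) (by positivity)
    · intro E₀ hE
      have hB2 : B ≤ Γ.meanCost γ α 0 := by
        refine hBp.trans (le_trans ?_ (hΓ.le_meanCost_zero hγ ha hα hn))
        rwa [div_mul_eq_mul_div, div_le_iff₀' (by positivity)] at hlarge
      obtain ⟨l, hl0, hl, hlB⟩ := Geometry.IsCoherent.exists_meanCost_eq Γ hγ hα hB.1 hB2
      refine hΓ.le_uniformProb_navigableBy hγ hφ hlam0 hlam1 hα hl0 hl hlB hn ?_ ?_ hE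
      · rwa [div_le_iff₀' hε] at hnε
      · have h3 : Real.log n ^ 3 ≤ Real.log n ^ (p + 3) := pow_le_pow_right₀ hn (by omega)
        calc Cn * Real.log n ^ 3 ≤ Cn * Real.log n ^ (p + 3) := by gcongr
          _ ≤ _ := by
              gcongr
              have : 0 < α * Cb := by positivity
              linarith
  · filter_upwards [eventually_log_ge 24, eventually_mul_log_pow_le
      ((9 * (1 / Real.log γ + 2) + Real.log γ * (1 / Real.log γ + 2) ^ 2 + 1) / (3 * a / 16)) 3]
      with n hn hlarge Γ hΓ
    have hn1 : 1 ≤ Real.log n := by linarith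
    have hpos := hΓ.meanCost_pos hγ ha hα hn1 (α * Real.log γ)
    refine ⟨_, ⟨le_rfl, le_mul_of_one_le_right hpos.le (one_le_pow₀ hn1)⟩, α * Real.log γ,
      by positivity, Γ.isOptimalProfile_gibbs γ (by positivity), ?_, fun u v huv => ?_⟩
    · refine hΓ.isSandwichedBy_rank hγ ha hα hn ?_
      rwa [div_mul_eq_mul_div, div_le_iff₀' (by positivity)] at hlarge
    · obtain ⟨k, hk, hs⟩ := hΓ.exists_scale u v huv
      have hQ : gibbsMatrix (Γ.indexingCost γ α) (α * Real.log γ) s(u, v) = 1 / (1 + γ ^ k) := by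
        have hidx : Γ.indexingCost γ α s(u, v) = (k : ℝ) / α := by
          rw [Geometry.indexingCost]
          exact congrArg (fun j : ℕ => (j : ℝ) / α) (scaleIndex_eq hγ hs)
        rw [gibbsMatrix, hidx, exp_mul_scale_eq hγ hα]
      have hγk : 0 < γ ^ k := pow_pos (by linarith) k
      have h1 := hΓ.le_ballCount hγ ha hk hs
      have h2 := hΓ.ballCount_le hγ hA0 hk hs
      have hmin : 0 < min (a / (2 * γ)) (1 / (1 + γ)) := by
        have : 0 < γ := by linarith
        positivity
      have hN : (0 : ℝ) < Γ.ballCount u (Γ.dist u v) :=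
        (mul_pos hmin (by linarith)).trans_le h1
      rw [hQ]
      constructor
      · rw [div_le_div_iff₀ hN (by linarith), one_mul]
        exact h1
      · rw [div_le_div_iff₀ (by linarith) hN, one_mul]
        exact h2
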